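/- Let $n\ge 1$ and fix a homogeneous Littlewood–Paley decomposition of $\mathbb R^n$: a smooth $\varphi:\mathbb R^n\to[0,1]$ supported in $\{3/4\le|\xi|\le 8/3\}$ with $\sum_{q\in\mathbb Z}\varphi(2^{-q}\xi)=1$ for $\xi\neq 0$, and $\dot\Delta_q f=\varphi(2^{-q}D)f$ for tempered distributions $f$. For $s\in\mathbb R$ put $$\|f\|_{\dot B^{s}_{2,1}}=\sum_{q\in\mathbb Z}2^{qs}\|\dot\Delta_q f\|_{L^2},\qquad \|f\|_{\dot B^{s}_{2,\infty}}=\sup_{q\in\mathbb Z}2^{qs}\|\dot\Delta_q f\|_{L^2},$$ let $\dot B^{s}_{2,1}$, $\dot B^{s}_{2,\infty}$ be the spaces of tempered distributions (modulo polynomials) for which these are finite, let the norm of a vector be the sum of the norms of its components, and let $\|\cdot\|_{X\cap Y}=\|\cdot\|_X+\|\cdot\|_Y$. For every $\beta>0$ there is $\tau_0>0$, depending only on $\beta$, such that the following holds for all $\tau$ with $0<\tau<\beta$ and $\tau<\tau_0$, and for all $\sigma,s\in\mathbb R$ with $\sigma+s+1>0$. There is a constant $C\ge 0$, which depends only on $n,\varphi,\beta,\tau,\sigma,s$,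 such that, whenever $u$ is a solution, with values in the tempered distributions on $\mathbb R^n$, of $$\tau u_{ttt}+u_{tt}-\Delta u-\beta\Delta u_t=0\quad (x\in\mathbb R^n,\ t>0),\qquad u(0)=u_0,\ u_t(0)=u_1,\ u_{tt}(0)=u_2,$$ and $v=u_t$, $w=u_{tt}$, $w_0=u_2$, $\mathbf V_0=\big(u_1+\tau u_2,\ \nabla(u_0+\tau u_1),\ \nabla u_1\big)$ satisfy $\mathbf V_0\in\dot B^{\sigma+1}_{2,1}\cap\dot B^{-s}_{2,\infty}$ and $w_0\in\dot B^{\sigma}_{2,1}$, then for all $t\ge 0$ one has $w(t)\in\dot B^{\sigma}_{2,1}$ and $$\|w(t)\|_{\dot B^{\sigma}_{2,1}}\le C\Big(\|\mathbf V_0\|_{\dot B^{\sigma+1}_{2,1}\cap\dot B^{-s}_{2,\infty}}+\|w_0\|_{\dot B^{\sigma}_{2,1}}\Big)(1+t)^{-\frac{\sigma+s+1}{2}} .$$ Here the equation means the system $u_t=v$, $v_t=w$, $\tau w_t=\Delta u+\beta\Delta v-w$ on $[0,\infty)$, where the time derivatives (one-sided at $t=0$) are taken after pairing with an arbitrary Schwartz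 function. -/

import Mathlib

open scoped ENNReal NNReal SchwartzMap LineDeriv Laplacian

noncomputable section

/-- The space `ℝⁿ` with its Euclidean norm. -/
abbrev Rn (n : ℕ) : Type := EuclideanSpace ℝ (Fin n)

/-- The dyadic cut-off function of a homogeneous Littlewood-Paley decomposition of `ℝⁿ`: a smooth
function `φ` with values in `[0,1]`, supported in the annulus `3/4 ≤ |ξ| ≤ 8/3`, such that
`∑_{q ∈ ℤ} φ(2^{-q} ξ) = 1` for every `ξ ≠ 0`. -/
structure LittlewoodPaley (n : ℕ) where
  φ : Rn n → ℝ
  smooth : ContDiff ℝ (⊤ : ℕ∞) φ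
  mem_Icc : ∀ ξ, φ ξ ∈ Set.Icc (0 : ℝ) 1
  support_subset : Function.support φ ⊆ {ξ | 3 / 4 ≤ ‖ξ‖ ∧ ‖ξ‖ ≤ 8 / 3}
  hasSum_one : ∀ ξ : Rn n, ξ ≠ 0 → HasSum (fun q : ℤ => φ ((2 : ℝ) ^ (-q) • ξ)) 1

/-- The `L^p` norm of a tempered distribution, with value `∞` when the distribution is not given
by an `L^p` function (the function is unique when it exists). -/
def distLpNorm {n : ℕ} (p : ℝ≥0∞) [Fact (1 ≤ p)] (f : 𝓢'(Rn n, ℂ)) : ℝ≥0∞ :=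
  ⨅ (g : MeasureTheory.Lp ℂ p (MeasureTheory.volume : MeasureTheory.Measure (Rn n)))
    (_ : MeasureTheory.Lp.toTemperedDistribution g = f), ‖g‖ₑ

namespace LittlewoodPaley

variable {n : ℕ} (P : LittlewoodPaley n)

/-- The homogeneous dyadic block `Δ̇_q f = φ(2^{-q} D) f`. The symbol is taken with respect to the
Fourier transform `∫ e^{-i x·ξ} f(x) dx`; Mathlib's transform is `∫ e^{-2πi x·ξ} f(x) dx`, whence
the factor `2π`. -/
def block (q : ℤ) (f : 𝓢'(Rn n, ℂ)) : 𝓢'(Rn n, ℂ) :=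
  TemperedDistribution.fourierMultiplierCLM ℂ
    (fun ξ : Rn n => ((P.φ ((2 : ℝ) ^ (-q) • (2 * Real.pi) • ξ) : ℝ) : ℂ)) f

/-- The homogeneous Besov norm `‖f‖_{Ḃ^s_{p,r}}`, with values in `[0,∞]`. It vanishes on
polynomials, so it is a function of the class of `f` modulo polynomials. -/
def besovNorm (s : ℝ) (p r : ℝ≥0∞) [Fact (1 ≤ p)] (f : 𝓢'(Rn n, ℂ)) : ℝ≥0∞ :=
  if r = ∞ then
    ⨆ q : ℤ, (2 : ℝ≥0∞) ^ ((q : ℝ) * s) * distLpNorm p (P.block q f)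
  else
    (∑' q : ℤ, ((2 : ℝ≥0∞) ^ ((q : ℝ) * s) * distLpNorm p (P.block q f)) ^ r.toReal) ^
      (1 / r.toReal)

/-- Membership of a tempered distribution (modulo polynomials) in `Ḃ^s_{p,r}`. -/
def MemBesov (s : ℝ) (p r : ℝ≥0∞) [Fact (1 ≤ p)] (f : 𝓢'(Rn n, ℂ)) : Prop :=
  P.besovNorm s p r f < ∞

/-- The homogeneous Besov norm of a vector of distributions: the sum of the norms of its
components. -/
def vecBesovNorm {ι : Type*} [Fintype ι] (s : ℝ) (p r : ℝ≥0∞) [Fact (1 ≤ p)]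
    (f : ι → 𝓢'(Rn n, ℂ)) : ℝ≥0∞ :=
  ∑ i, P.besovNorm s p r (f i)

/-- All components of a vector of distributions belong to `Ḃ^s_{p,r}`. -/
def VecMemBesov {ι : Type*} (s : ℝ) (p r : ℝ≥0∞) [Fact (1 ≤ p)]
    (f : ι → 𝓢'(Rn n, ℂ)) : Prop :=
  ∀ i, P.MemBesov s p r (f i)

end LittlewoodPaley

/-- The `i`-th partial derivative of a tempered distribution on `ℝⁿ`. -/
def pderivDist {n : ℕ} (i : Fin n) (f : 𝓢'(Rn n, ℂ)) : 𝓢'(Rn n, ℂ) :=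
  ∂_{(EuclideanSpace.single i (1 : ℝ) : Rn n)} f

/-- The vector `V = (v + τ w, ∇(u + τ v), ∇v)`, which has `1 + n + n` components. -/
def vectorV {n : ℕ} (τ : ℝ) (u v w : 𝓢'(Rn n, ℂ)) : Unit ⊕ Fin n ⊕ Fin n → 𝓢'(Rn n, ℂ) :=
  Sum.elim (fun _ => v + (τ : ℂ) • w)
    (Sum.elim (fun i => pderivDist i (u + (τ : ℂ) • v)) (fun i => pderivDist i v))

/-- `(u, v, w) = (u, u_t, u_tt)` where `u` solves the Cauchy problem on `[0,∞) × ℝⁿ`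
`τ u_ttt + u_tt - Δu - β Δu_t = 0`, `u(0) = u₀`, `u_t(0) = u₁`, `u_tt(0) = u₂`,
written as the first order system `u_t = v`, `v_t = w`, `τ w_t = Δu + β Δv - w`.
The solution takes values in tempered distributions on `ℝⁿ`, and the time derivatives (one-sided
at `t = 0`) are those of the pairings with Schwartz functions. -/
structure IsMGTSolution {n : ℕ} (τ β : ℝ) (u₀ u₁ u₂ : 𝓢'(Rn n, ℂ))
    (u v w : ℝ → 𝓢'(Rn n, ℂ)) : Prop where
  init_u : u 0 = u₀
  init_v : v 0 = u₁
  init_w : w 0 = u₂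
  deriv_u : ∀ g : 𝓢(Rn n, ℂ), ∀ t : ℝ, 0 ≤ t →
    HasDerivWithinAt (fun r => u r g) (v t g) (Set.Ici 0) t
  deriv_v : ∀ g : 𝓢(Rn n, ℂ), ∀ t : ℝ, 0 ≤ t →
    HasDerivWithinAt (fun r => v r g) (w t g) (Set.Ici 0) t
  deriv_w : ∀ g : 𝓢(Rn n, ℂ), ∀ t : ℝ, 0 ≤ t →
    HasDerivWithinAt (fun r => (τ : ℂ) * w r g)
      ((Δ (u t) + (β : ℂ) • Δ (v t) - w t) g) (Set.Ici 0) t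

end

/-! ### Completeness of the Schwartz space -/

section SchwartzComplete

open Filter Topology

variable {E F : Type*} [NormedAddCommGroup E] [NormedSpace ℝ E]
  [NormedAddCommGroup F] [NormedSpace ℝ F]

/-! On the Fourier side the equation is a linear ODE at each frequency, with κ = k², k = 2π‖ξ‖. With
a = u + τv, p = v + τw and γ = β - τ > 0 it reads a' = p, p' = -κ(a + γv), τv' = p - v. The energy
p² + κa² + γτκv² dissipates only through v; small cross terms turn it into a Lyapunov function with
decay rate cκ/(1 + κ), heat-like at low and uniform at high frequency. Since τw' + w = -κ(a + γv), w
relaxes to a source that is at most a constant times k times the root of the energy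
(`exists_freq_decay`). That factor k is why the data are measured one derivative higher and why the
exponent is (σ + s + 1)/2.

A distributional solution is treated one dyadic block at a time. A block of the data is an L²
function on an annulus, and the matrix exponential evolves it into an L² solution. Uniqueness
identifies this with the block of the given solution: on a block the Laplacian is multiplication by
a Schwartz function, so Banach–Steinhaus and a Picard iteration apply
(`TemperedDistribution.eq_zero_of_hasDerivWithinAt`). The result is `exists_block_decay`.

In the sum over blocks, q ≥ 0 gives exponential decay against the norm of order σ + 1. For q < 0 the
norm of order -s leaves ∑ 2^(q(σ+s+1)) exp(-c 4^q t), which is of order (1+t)^(-(σ+s+1)/2) because σ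
+ s + 1 > 0 (`exists_low_frequency_sum_le`). -/

instance SchwartzMap.instCountablyGeneratedUniformity :
    (uniformity 𝓢(E, F)).IsCountablyGenerated :=
  IsUniformAddGroup.uniformity_countably_generated

theorem SchwartzMap.seminorm_le_sup_Iic {k n N : ℕ} (hk : k ≤ N) (hn : n ≤ N) (f : 𝓢(E, F)) :
    SchwartzMap.seminorm ℝ k n f ≤
      (Finset.Iic (N, N)).sup (schwartzSeminormFamily ℝ E F) f :=
  Seminorm.le_def.1 (Finset.le_sup (f := schwartzSeminormFamily ℝ E F)
    (b := (k, n)) (Finset.mem_Iic.2 (Prod.mk_le_mk.2 ⟨hk, hn⟩))) f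

/-- The limit is the telescoping series `u 0 + ∑ (u (j + 1) - u j)`. Each fixed seminorm of its
terms is eventually at most 2^(-j), so it can be differentiated termwise; letting l → ∞ in the
weighted bounds for `u l - u m` gives decay and convergence. -/
theorem SchwartzMap.exists_tendsto_of_controlled [CompleteSpace F] (u : ℕ → 𝓢(E, F))
    (hu : ∀ N m l : ℕ, N ≤ m → N ≤ l →
      (Finset.Iic (N, N)).sup (schwartzSeminormFamily ℝ E F) (u m - u l) ≤ (1 / 2 : ℝ) ^ N) :
    ∃ f : 𝓢(E, F), Tendsto u atTop (𝓝 f) := by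
  have hsem : ∀ k n N m l : ℕ, k ≤ N → n ≤ N → N ≤ m → N ≤ l →
      SchwartzMap.seminorm ℝ k n (u m - u l) ≤ (1 / 2 : ℝ) ^ N := fun k n N m l hk hn hm hl =>
    (seminorm_le_sup_Iic hk hn _).trans (hu N m l hm hl)
  set d : ℕ → 𝓢(E, F) := fun j => u (j + 1) - u j with hd
  have hsum : ∀ k n : ℕ, Summable fun j => SchwartzMap.seminorm ℝ k n (d j) := by
    intro k n
    refine Summable.of_norm_bounded_eventually_nat (g := fun j => (1 / 2 : ℝ) ^ j)
      (summable_geometric_of_lt_one (by norm_num) (by norm_num)) ?_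
    filter_upwards [eventually_ge_atTop (max k n)] with j hj
    rw [Real.norm_of_nonneg (apply_nonneg _ _)]
    exact hsem k n j _ _ (le_of_max_le_left hj) (le_of_max_le_right hj) (by omega) le_rfl
  have hdsm : ∀ j, ContDiff ℝ (⊤ : ℕ∞) (d j) := fun j => (d j).smooth ⊤
  have hv : ∀ k : ℕ, (k : ℕ∞) ≤ ⊤ → Summable ((fun k j => SchwartzMap.seminorm ℝ 0 k (d j)) k) :=
    fun k _ => hsum 0 k
  have hb : ∀ (k j : ℕ) (x : E), (k : ℕ∞) ≤ ⊤ → ‖iteratedFDeriv ℝ k (d j) x‖ ≤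
      (fun k j => SchwartzMap.seminorm ℝ 0 k (d j)) k j := fun k j x _ =>
    (d j).norm_iteratedFDeriv_le_seminorm ℝ k x
  have hTsm : ContDiff ℝ (⊤ : ℕ∞) fun x => ∑' j, d j x := contDiff_tsum hdsm hv hb
  set T : E → F := fun x => u 0 x + ∑' j, d j x with hT
  have hTs : ContDiff ℝ (⊤ : ℕ∞) T := ((u 0).smooth ⊤).add hTsm
  have hlim : ∀ (n : ℕ) (x : E),
      Tendsto (fun l => iteratedFDeriv ℝ n (u l) x) atTop (𝓝 (iteratedFDeriv ℝ n T x)) := by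
    intro n x
    have h1 : iteratedFDeriv ℝ n T x =
        iteratedFDeriv ℝ n (u 0) x + ∑' j, iteratedFDeriv ℝ n (d j) x := by
      have := iteratedFDeriv_tsum hdsm hv hb (k := n) le_top
      rw [← congrFun this x, hT]
      exact iteratedFDeriv_add_apply (((u 0).smooth n).contDiffAt)
        ((hTsm.of_le (by exact_mod_cast le_top)).contDiffAt)
    have h2 : Summable fun j => iteratedFDeriv ℝ n (d j) x :=
      Summable.of_norm_bounded (hsum 0 n) fun j => hb n j x le_top
    have h3 : ∀ l, ∑ j ∈ Finset.range l, iteratedFDeriv ℝ n (d j) x =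
        iteratedFDeriv ℝ n (u l) x - iteratedFDeriv ℝ n (u 0) x := by
      intro l
      rw [← Finset.sum_range_sub (fun l => iteratedFDeriv ℝ n (u l) x)]
      refine Finset.sum_congr rfl fun j _ => ?_
      exact iteratedFDeriv_sub_apply (((u (j + 1)).smooth n).contDiffAt)
        (((u j).smooth n).contDiffAt)
    have h4 := (h2.hasSum.tendsto_sum_nat).const_add (iteratedFDeriv ℝ n (u 0) x)
    simp only [h3, add_sub_cancel] at h4
    rwa [h1]
  have hclose : ∀ (k n m : ℕ) (x : E), k ≤ m → n ≤ m →
      ‖x‖ ^ k * ‖iteratedFDeriv ℝ n T x - iteratedFDeriv ℝ n (u m) x‖ ≤ (1 / 2 : ℝ) ^ m := by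
    intro k n m x hk hn
    refine le_of_tendsto (((hlim n x).sub_const _).norm.const_mul (‖x‖ ^ k)) ?_
    filter_upwards [eventually_ge_atTop m] with l hl
    have := (u l - u m).le_seminorm ℝ k n x
    rw [show (⇑(u l - u m) : E → F) = ⇑(u l) - ⇑(u m) from rfl, iteratedFDeriv_sub_apply
      (((u l).smooth n).contDiffAt) (((u m).smooth n).contDiffAt)] at this
    exact this.trans (hsem k n m l m hk hn hl le_rfl)
  let f : 𝓢(E, F) :=
    { toFun := T
      smooth' := hTs
      decay' := by
        intro k n
        refine ⟨(1 / 2 : ℝ) ^ (max k n) + SchwartzMap.seminorm ℝ k n (u (max k n)), fun x => ?_⟩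
        have h1 := hclose k n (max k n) x (le_max_left _ _) (le_max_right _ _)
        have h2 := (u (max k n)).le_seminorm ℝ k n x
        calc ‖x‖ ^ k * ‖iteratedFDeriv ℝ n T x‖
            ≤ ‖x‖ ^ k * (‖iteratedFDeriv ℝ n T x - iteratedFDeriv ℝ n (u (max k n)) x‖
              + ‖iteratedFDeriv ℝ n (u (max k n)) x‖) := by
              gcongr
              simpa using norm_add_le (iteratedFDeriv ℝ n T x -
                iteratedFDeriv ℝ n (u (max k n)) x) (iteratedFDeriv ℝ n (u (max k n)) x)
          _ ≤ _ := by rw [mul_add]; exact add_le_add h1 h2 }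
  refine ⟨f, ?_⟩
  rw [(schwartz_withSeminorms ℝ E F).tendsto_nhds_atTop]
  rintro ⟨k, n⟩ ε hε
  obtain ⟨N, hN⟩ := exists_pow_lt_of_lt_one hε (by norm_num : (1 / 2 : ℝ) < 1)
  refine ⟨max N (max k n), fun m hm => ?_⟩
  have hm1 : N ≤ m := le_of_max_le_left hm
  have hm2 : k ≤ m := (le_max_left _ _).trans (le_of_max_le_right hm)
  have hm3 : n ≤ m := (le_max_right _ _).trans (le_of_max_le_right hm)
  refine lt_of_le_of_lt ?_ (lt_of_le_of_lt
    (pow_le_pow_of_le_one (by norm_num) (by norm_num) hm1) hN)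
  refine SchwartzMap.seminorm_le_bound ℝ k n _ (by positivity) fun x => ?_
  rw [show (⇑(u m - f) : E → F) = ⇑(u m) - T from rfl, iteratedFDeriv_sub_apply
      (((u m).smooth n).contDiffAt) ((hTs.of_le (by exact_mod_cast le_top)).contDiffAt),
      norm_sub_rev]
  exact hclose k n m x hm2 hm3

/-- Completeness and metrizability make the Schwartz space Baire, hence barrelled, as the uniform
boundedness principle requires. -/
instance SchwartzMap.instCompleteSpace [CompleteSpace F] : CompleteSpace 𝓢(E, F) := by
  let p : ℕ → Seminorm ℝ 𝓢(E, F) := fun N =>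
    (Finset.Iic (N, N)).sup (schwartzSeminormFamily ℝ E F)
  refine UniformSpace.complete_of_convergent_controlled_sequences
    (fun N => {x : 𝓢(E, F) × 𝓢(E, F) | p N (x.2 - x.1) < (1 / 2 : ℝ) ^ N}) ?_ ?_
  · intro N
    rw [uniformity_eq_comap_nhds_zero]
    refine ⟨(p N).ball 0 ((1 / 2 : ℝ) ^ N), ?_, ?_⟩
    · exact (schwartz_withSeminorms ℝ E F).mem_nhds_iff _ _ |>.2
        ⟨Finset.Iic (N, N), (1 / 2 : ℝ) ^ N, by positivity, subset_rfl⟩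
    · intro x hx
      simpa [Seminorm.mem_ball] using hx
  · intro u hu
    refine SchwartzMap.exists_tendsto_of_controlled u fun N m l hm hl => ?_
    exact (hu N l m hl hm).le

end SchwartzComplete

/-! ### Uniform boundedness for tempered distributions -/

section UniformBound

open Filter Topology

variable {E : Type*} [NormedAddCommGroup E] [NormedSpace ℝ E]

/-- Uniform boundedness principle for tempered distributions: a pointwise bounded family is
bounded by a single Schwartz seminorm. -/
theorem TemperedDistribution.exists_seminorm_bound {ι : Type*} (T : ι → 𝓢'(E, ℂ))
    (hT : ∀ g : 𝓢(E, ℂ), ∃ C : ℝ, ∀ i, ‖T i g‖ ≤ C) :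
    ∃ (N : ℕ) (C : ℝ), 0 ≤ C ∧ ∀ i g, ‖T i g‖ ≤
      C * (Finset.Iic (N, N)).sup (schwartzSeminormFamily ℂ E ℂ) g := by
  let p : ι → Seminorm ℂ 𝓢(E, ℂ) := fun i => (normSeminorm ℂ ℂ).comp (T i).toLinearMap
  have hbdd : BddAbove (Set.range p) := by
    rw [Seminorm.bddAbove_range_iff]
    intro g
    obtain ⟨C, hC⟩ := hT g
    exact ⟨C, by rintro _ ⟨i, rfl⟩; exact hC i⟩
  have hp : ∀ i, Continuous (p i) := fun i => continuous_norm.comp (T i).continuous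
  -- Barrelledness is used here.
  have hcont := Seminorm.continuous_iSup p hp hbdd
  have hcont' : Continuous (⨆ i, p i : Seminorm ℂ 𝓢(E, ℂ)) := by
    rwa [← Seminorm.coe_iSup_eq hbdd] at hcont
  obtain ⟨s, C, -, hC⟩ := Seminorm.bound_of_continuous (schwartz_withSeminorms ℂ E ℂ) _ hcont'
  obtain ⟨N, hN⟩ : ∃ N, s ⊆ Finset.Iic (N, N) := by
    refine ⟨s.sup (fun a => max a.1 a.2), fun a ha => ?_⟩
    have := Finset.le_sup (f := fun a : ℕ × ℕ => max a.1 a.2) ha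
    exact Finset.mem_Iic.2 ⟨(le_max_left _ _).trans this, (le_max_right _ _).trans this⟩
  refine ⟨N, C, C.2, fun i g => ?_⟩
  have h1 : p i g ≤ (⨆ i, p i : Seminorm ℂ 𝓢(E, ℂ)) g := by
    rw [Seminorm.iSup_apply hbdd]
    exact le_ciSup (f := fun i => p i g) (Seminorm.bddAbove_range_iff.1 hbdd g) i
  have h2 := Seminorm.le_def.1 hC g
  have h3 : s.sup (schwartzSeminormFamily ℂ E ℂ) g ≤
      (Finset.Iic (N, N)).sup (schwartzSeminormFamily ℂ E ℂ) g :=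
    Seminorm.le_def.1 (Finset.sup_mono hN) g
  calc ‖T i g‖ = p i g := rfl
    _ ≤ C * s.sup (schwartzSeminormFamily ℂ E ℂ) g := h1.trans h2
    _ ≤ _ := by gcongr

/-- Multiplication by a Schwartz function is bounded for the seminorm
`(Finset.Iic (N, N)).sup`. -/
theorem SchwartzMap.exists_sup_seminorm_smulLeftCLM_le (K : 𝓢(E, ℂ)) (N : ℕ) :
    ∃ M : ℝ, 0 ≤ M ∧ ∀ g : 𝓢(E, ℂ),
      (Finset.Iic (N, N)).sup (schwartzSeminormFamily ℂ E ℂ) (SchwartzMap.smulLeftCLM ℂ K g) ≤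
        M * (Finset.Iic (N, N)).sup (schwartzSeminormFamily ℂ E ℂ) g := by
  set P := (Finset.Iic (N, N)).sup (schwartzSeminormFamily ℂ E ℂ) with hP
  set A : ℝ := ∑ i ∈ Finset.range (N + 1), SchwartzMap.seminorm ℂ 0 i K with hA
  have hA0 : 0 ≤ A := Finset.sum_nonneg fun i _ => apply_nonneg _ _
  -- Leibniz's rule: `A` bounds the derivatives of `K`, the binomial coefficients sum to at most
  -- 2^N, and the weight stays on `g`. The same `N` on both sides lets the bound be iterated without
  -- loss of derivatives.
  refine ⟨2 ^ N * A, by positivity, fun g => ?_⟩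
  have hPg : 0 ≤ P g := apply_nonneg _ _
  refine Seminorm.finset_sup_apply_le (by positivity) fun ⟨k, n⟩ hkn => ?_
  obtain ⟨hk, hn⟩ : k ≤ N ∧ n ≤ N := Finset.mem_Iic.1 hkn
  refine SchwartzMap.seminorm_le_bound ℂ k n _ (by positivity) fun x => ?_
  have hfun : (⇑(SchwartzMap.smulLeftCLM ℂ K g) : E → ℂ) = fun x => K x * g x := by
    ext y; simp [SchwartzMap.smulLeftCLM_apply_apply K.hasTemperateGrowth]
  rw [hfun]
  have h1 := norm_iteratedFDeriv_mul_le (𝕜 := ℝ) (N := n) (K.smooth n) (g.smooth n) x le_rfl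
  calc ‖x‖ ^ k * ‖iteratedFDeriv ℝ n (fun x => K x * g x) x‖
      ≤ ‖x‖ ^ k * ∑ i ∈ Finset.range (n + 1), (n.choose i : ℝ) * ‖iteratedFDeriv ℝ i K x‖ *
          ‖iteratedFDeriv ℝ (n - i) g x‖ := by gcongr
    _ = ∑ i ∈ Finset.range (n + 1), (n.choose i : ℝ) * (‖iteratedFDeriv ℝ i K x‖ *
          (‖x‖ ^ k * ‖iteratedFDeriv ℝ (n - i) g x‖)) := by
        rw [Finset.mul_sum]; refine Finset.sum_congr rfl fun i _ => by ring
    _ ≤ ∑ i ∈ Finset.range (n + 1), (n.choose i : ℝ) * (A * P g) := by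
        refine Finset.sum_le_sum fun i hi => ?_
        have hi' : i ≤ n := Nat.lt_succ_iff.1 (Finset.mem_range.1 hi)
        gcongr
        · refine (K.norm_iteratedFDeriv_le_seminorm ℂ i x).trans ?_
          exact Finset.single_le_sum (f := fun i => SchwartzMap.seminorm ℂ 0 i K)
            (fun i _ => apply_nonneg _ _) (Finset.mem_range.2 (by omega))
        · refine (g.le_seminorm ℂ k (n - i) x).trans ?_
          exact Seminorm.le_def.1 (Finset.le_sup (f := schwartzSeminormFamily ℂ E ℂ)
            (b := (k, n - i)) (Finset.mem_Iic.2 (Prod.mk_le_mk.2 ⟨hk, (Nat.sub_le _ _).trans hn⟩))) g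
    _ = 2 ^ n * (A * P g) := by
        rw [← Finset.sum_mul]; congr 1; exact_mod_cast Nat.sum_range_choose n
    _ ≤ 2 ^ N * (A * P g) := by
        gcongr; norm_num
    _ = _ := by ring

end UniformBound

/-! ### Uniqueness by Picard iteration -/

section Uniqueness

variable {E : Type*} [NormedAddCommGroup E] [NormedSpace ℝ E]

/-- One step of the Picard iteration: the new bound is the primitive of the old one. -/
theorem norm_le_pow_div_factorial_of_deriv {f f' : ℝ → ℂ} {T A : ℝ} {k : ℕ}
    (hf : ∀ t, 0 ≤ t → HasDerivWithinAt f (f' t) (Set.Ici 0) t) (h0 : f 0 = 0)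
    (hb : ∀ t ∈ Set.Icc 0 T, ‖f' t‖ ≤ A * (t ^ k / k.factorial)) :
    ∀ t ∈ Set.Icc 0 T, ‖f t‖ ≤ A * (t ^ (k + 1) / (k + 1).factorial) := by
  refine image_norm_le_of_norm_deriv_right_le_deriv_boundary (f' := f')
    (B' := fun t => A * (t ^ k / k.factorial))
    (fun t ht => ((hf t ht.1).mono Set.Icc_subset_Ici_self).continuousWithinAt)
    (fun t ht => (hf t ht.1).mono (Set.Ici_subset_Ici.2 ht.1)) (by simp [h0]) (fun t => ?_)
    (fun t ht => hb t ⟨ht.1, ht.2.le⟩)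
  have h := ((hasDerivAt_pow (k + 1) t).div_const ((k + 1).factorial : ℝ)).const_mul A
  convert! h using 1
  rw [Nat.factorial_succ]
  have : (k.factorial : ℝ) ≠ 0 := by positivity
  push_cast
  field_simp

/-- Uniqueness for a linear system of first order with a bounded symbol, in the space of tempered
distributions. -/
theorem TemperedDistribution.eq_zero_of_hasDerivWithinAt (K : 𝓢(E, ℂ)) (a b c : ℝ)
    {x y z : ℝ → 𝓢'(E, ℂ)}
    (hx : ∀ g t, 0 ≤ t → HasDerivWithinAt (fun r => x r g) (y t g) (Set.Ici 0) t)
    (hy : ∀ g t, 0 ≤ t → HasDerivWithinAt (fun r => y r g) (z t g) (Set.Ici 0) t)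
    (hz : ∀ g t, 0 ≤ t → HasDerivWithinAt (fun r => z r g)
      (a * x t (SchwartzMap.smulLeftCLM ℂ K g) + b * y t (SchwartzMap.smulLeftCLM ℂ K g) +
        c * z t g) (Set.Ici 0) t)
    (hx0 : x 0 = 0) (hy0 : y 0 = 0) (hz0 : z 0 = 0) (t : ℝ) (ht : 0 ≤ t) : z t = 0 := by
  have hbd : ∀ {w w' : ℝ → 𝓢'(E, ℂ)},
      (∀ g t, 0 ≤ t → HasDerivWithinAt (fun r => w r g) (w' t g) (Set.Ici 0) t) →
      ∀ g : 𝓢(E, ℂ), ∃ C : ℝ, ∀ i : Set.Icc (0 : ℝ) t, ‖w i g‖ ≤ C := by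
    intro w w' hw g
    obtain ⟨C, hC⟩ := (isCompact_Icc (a := (0 : ℝ)) (b := t)).exists_bound_of_continuousOn
      (f := fun r => w r g) fun r hr =>
        ((hw g r hr.1).mono Set.Icc_subset_Ici_self).continuousWithinAt
    exact ⟨C, fun i => hC i i.2⟩
  have hbz : ∀ g : 𝓢(E, ℂ), ∃ C : ℝ, ∀ i : Set.Icc (0 : ℝ) t, ‖z i g‖ ≤ C := by
    intro g
    obtain ⟨C, hC⟩ := (isCompact_Icc (a := (0 : ℝ)) (b := t)).exists_bound_of_continuousOn
      (f := fun r => z r g) fun r hr =>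
        ((hz g r hr.1).mono Set.Icc_subset_Ici_self).continuousWithinAt
    exact ⟨C, fun i => hC i i.2⟩
  -- Pairings are continuous, hence bounded, on [0, t]. Indexing by `Fin 3` as well yields one
  -- seminorm for all three components.
  obtain ⟨N, C, hC0, hC⟩ := TemperedDistribution.exists_seminorm_bound
    (ι := Fin 3 × Set.Icc (0 : ℝ) t) (fun i => ![x i.2, y i.2, z i.2] i.1) (fun g => by
      obtain ⟨C1, h1⟩ := hbd hx g
      obtain ⟨C2, h2⟩ := hbd hy g
      obtain ⟨C3, h3⟩ := hbz g
      refine ⟨max C1 (max C2 C3), ?_⟩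
      rintro ⟨i, r⟩
      fin_cases i
      · exact (h1 r).trans (le_max_left _ _)
      · exact (h2 r).trans ((le_max_left _ _).trans (le_max_right _ _))
      · exact (h3 r).trans ((le_max_right _ _).trans (le_max_right _ _)))
  set p := (Finset.Iic (N, N)).sup (schwartzSeminormFamily ℂ E ℂ) with hp
  obtain ⟨L, hL0, hL⟩ := SchwartzMap.exists_sup_seminorm_smulLeftCLM_le K N
  -- The summand 1 gives M ≥ 1, so that x' = y and y' = z also fit the factor `M` gained at each
  -- step.
  set M : ℝ := 1 + |a| * L + |b| * L + |c| with hM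
  have hM1 : 1 ≤ M := by
    have : 0 ≤ |a| * L := by positivity
    have : 0 ≤ |b| * L := by positivity
    have := abs_nonneg c
    linarith
  have key : ∀ k : ℕ, ∀ g : 𝓢(E, ℂ), ∀ r ∈ Set.Icc (0 : ℝ) t,
      ‖x r g‖ ≤ C * M ^ k * p g * (r ^ k / k.factorial) ∧
      ‖y r g‖ ≤ C * M ^ k * p g * (r ^ k / k.factorial) ∧
      ‖z r g‖ ≤ C * M ^ k * p g * (r ^ k / k.factorial) := by
    intro k
    induction k with
    | zero =>
      intro g r hr
      simp only [pow_zero, Nat.factorial_zero, Nat.cast_one, div_one, mul_one]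
      exact ⟨hC (0, ⟨r, hr⟩) g, hC (1, ⟨r, hr⟩) g, hC (2, ⟨r, hr⟩) g⟩
    | succ k ih =>
      intro g
      have hpg : 0 ≤ p g := apply_nonneg _ _
      have hle : ∀ r : ℝ, 0 ≤ r → C * M ^ k * p g * (r ^ k / k.factorial) ≤
          C * M ^ (k + 1) * p g * (r ^ k / k.factorial) := by
        intro r hr
        have : M ^ k ≤ M ^ (k + 1) := pow_le_pow_right₀ hM1 (Nat.le_succ k)
        gcongr
      intro r hr
      refine ⟨norm_le_pow_div_factorial_of_deriv (hx g) (by simp [hx0])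
          (fun r hr => ((ih g r hr).2.1).trans (hle r hr.1)) r hr,
        norm_le_pow_div_factorial_of_deriv (hy g) (by simp [hy0])
          (fun r hr => ((ih g r hr).2.2).trans (hle r hr.1)) r hr,
        norm_le_pow_div_factorial_of_deriv (hz g) (by simp [hz0])
          (fun r hr => ?_) r hr⟩
      have hr0 : 0 ≤ r := hr.1
      set Kg := SchwartzMap.smulLeftCLM ℂ K g
      set q : ℝ := r ^ k / k.factorial with hq
      have hq0 : 0 ≤ q := by positivity
      have hx1 : ‖x r Kg‖ ≤ C * M ^ k * (L * p g) * q :=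
        ((ih Kg r hr).1).trans (by gcongr; exact hL g)
      have hy1 : ‖y r Kg‖ ≤ C * M ^ k * (L * p g) * q :=
        ((ih Kg r hr).2.1).trans (by gcongr; exact hL g)
      have hz1 := (ih g r hr).2.2
      calc ‖(a : ℂ) * x r Kg + b * y r Kg + c * z r g‖
          ≤ |a| * ‖x r Kg‖ + |b| * ‖y r Kg‖ + |c| * ‖z r g‖ := by
            refine (norm_add₃_le).trans (le_of_eq ?_)
            simp
        _ ≤ |a| * (C * M ^ k * (L * p g) * q) + |b| * (C * M ^ k * (L * p g) * q) +
            |c| * (C * M ^ k * p g * q) := by gcongr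
        _ = C * M ^ k * (|a| * L + |b| * L + |c|) * p g * q := by ring
        _ ≤ C * M ^ k * M * p g * q := by
            gcongr
            linarith
        _ = C * M ^ (k + 1) * p g * q := by ring
  ext g
  have h1 : Filter.Tendsto (fun k : ℕ => C * p g * ((M * t) ^ k / k.factorial))
      Filter.atTop (nhds (C * p g * 0)) :=
    (FloorSemiring.tendsto_pow_div_factorial_atTop (M * t)).const_mul _
  have h2 : ‖z t g‖ ≤ C * p g * 0 := by
    refine ge_of_tendsto' h1 fun k => ?_
    refine ((key k g t ⟨ht, le_rfl⟩).2.2).trans (le_of_eq ?_)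
    rw [mul_pow]; ring
  simpa using h2

end Uniqueness

/-! ### Decay at a fixed frequency -/

section Energy

/-- The quadratic form `p² + κ a² + γ τ κ v² + δ ρ (p a - 2 τ p v)`, a Lyapunov function of the
system satisfied by `a = u + τ v`, `p = v + τ w` and `v` at frequency `√κ`. -/
def lyapunov (τ γ δ κ ρ p a v : ℝ) : ℝ :=
  p ^ 2 + κ * a ^ 2 + γ * τ * κ * v ^ 2 + δ * ρ * (p * a - 2 * τ * (p * v))

/-- Makes `lyapunov` comparable to the energy, between one half and three halves of it. Young's
inequality suffices because ρ² ≤ κ. -/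
theorem lyapunov_cross_term_le {τ γ δ κ ρ : ℝ} (hτ : 0 < τ) (hδ : 0 < δ)
    (hδ1 : δ * (1 / 2 + τ) ≤ 1 / 2) (hδ2 : δ ≤ γ / 2) (hρ0 : 0 ≤ ρ) (hρ1 : ρ ≤ 1) (hρκ : ρ ≤ κ)
    (p a v : ℝ) :
    |δ * ρ * (p * a - 2 * τ * (p * v))| ≤ (p ^ 2 + κ * a ^ 2 + γ * τ * κ * v ^ 2) / 2 := by
  have hκ : 0 ≤ κ := hρ0.trans hρκ
  have hρ2 : ρ ^ 2 ≤ κ := by nlinarith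
  have h1 : |ρ * (p * a - 2 * τ * (p * v))| ≤
      (1 / 2 + τ) * (p ^ 2 + κ * a ^ 2) + τ * κ * v ^ 2 := by
    have ha : ρ ^ 2 * a ^ 2 ≤ κ * a ^ 2 := by gcongr
    have hv : τ * (ρ ^ 2 * v ^ 2) ≤ τ * (κ * v ^ 2) := by gcongr
    have hκa : 0 ≤ τ * (κ * a ^ 2) := by positivity
    rw [abs_le]
    constructor
    · nlinarith [sq_nonneg (p + ρ * a), mul_nonneg hτ.le (sq_nonneg (p - ρ * v))]
    · nlinarith [sq_nonneg (p - ρ * a), mul_nonneg hτ.le (sq_nonneg (p + ρ * v))]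
  rw [mul_assoc, abs_mul, abs_of_pos hδ]
  have h2 : δ * (1 / 2 + τ) * (p ^ 2 + κ * a ^ 2) ≤ 1 / 2 * (p ^ 2 + κ * a ^ 2) := by gcongr
  have h3 : δ * (τ * κ * v ^ 2) ≤ γ / 2 * (τ * κ * v ^ 2) := by gcongr
  have h4 := mul_le_mul_of_nonneg_left h1 hδ.le
  linarith

/-- The left side is the time derivative of `lyapunov`. The product p a damps κa² but creates +p²,
which -2τ p v turns into -p². Young's inequality absorbs the other terms in half of these two and, δ
being small, in half of 2γκv². -/
theorem lyapunov_dissipation {τ γ δ κ ρ : ℝ} (hτ : 0 < τ) (hγ : 0 < γ) (hδ : 0 < δ)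
    (hδ3 : δ * ((2 * τ - γ) ^ 2 / 2 + 2 * τ * γ + 2) ≤ γ)
    (hρ0 : 0 ≤ ρ) (hρ1 : ρ ≤ 1) (hρκ : ρ ≤ κ) (p a v : ℝ) :
    -2 * γ * κ * v ^ 2 + δ * ρ * (-p ^ 2 - κ * a ^ 2 + (2 * τ - γ) * κ * (a * v)
        + 2 * τ * γ * κ * v ^ 2 + 2 * (p * v)) ≤
      -(γ * κ * v ^ 2) - δ * ρ / 2 * (p ^ 2 + κ * a ^ 2) := by
  have hκ : 0 ≤ κ := hρ0.trans hρκ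
  have h1 : (2 * τ - γ) * κ * (a * v) ≤ κ * a ^ 2 / 2 + κ * ((2 * τ - γ) ^ 2 / 2 * v ^ 2) := by
    nlinarith [mul_nonneg hκ (sq_nonneg (a - (2 * τ - γ) * v))]
  have h2 : 2 * (p * v) ≤ p ^ 2 / 2 + 2 * v ^ 2 := by nlinarith [sq_nonneg (p - 2 * v)]
  have h3 : ρ * (κ * ((2 * τ - γ) ^ 2 / 2 * v ^ 2) + 2 * τ * γ * κ * v ^ 2) ≤
      1 * (κ * ((2 * τ - γ) ^ 2 / 2 * v ^ 2) + 2 * τ * γ * κ * v ^ 2) := by gcongr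
  have h4 : ρ * (2 * v ^ 2) ≤ κ * (2 * v ^ 2) := by gcongr
  have h5 : δ * ((2 * τ - γ) ^ 2 / 2 + 2 * τ * γ + 2) * (κ * v ^ 2) ≤ γ * (κ * v ^ 2) := by gcongr
  have h6 : δ * ρ * ((2 * τ - γ) * κ * (a * v) + 2 * (p * v)) ≤
      δ * ρ * (κ * a ^ 2 / 2 + κ * ((2 * τ - γ) ^ 2 / 2 * v ^ 2) + (p ^ 2 / 2 + 2 * v ^ 2)) := by
    gcongr
  have h7 := mul_le_mul_of_nonneg_left h3 hδ.le
  have h8 := mul_le_mul_of_nonneg_left h4 hδ.le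
  nlinarith

theorem le_exp_mul_of_deriv_le {f f' : ℝ → ℝ} {c : ℝ} (hf : ∀ t, HasDerivAt f (f' t) t)
    (hle : ∀ t, f' t ≤ -c * f t) (t : ℝ) (ht : 0 ≤ t) : f t ≤ Real.exp (-c * t) * f 0 := by
  have hd : ∀ t, HasDerivAt (fun t => Real.exp (c * t) * f t)
      (Real.exp (c * t) * (c * f t + f' t)) t := by
    intro t
    have h1 : HasDerivAt (fun t : ℝ => c * t) c t := by simpa using (hasDerivAt_id t).const_mul c
    convert! (h1.exp).mul (hf t) using 1
    ring
  have hanti : Antitone fun t => Real.exp (c * t) * f t :=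
    antitone_of_hasDerivAt_nonpos hd fun t =>
      mul_nonpos_of_nonneg_of_nonpos (Real.exp_pos _).le (by linarith [hle t])
  have h := hanti ht
  simp only [mul_zero, Real.exp_zero, one_mul] at h
  rw [neg_mul, Real.exp_neg, ← div_eq_inv_mul, le_div_iff₀ (Real.exp_pos _), mul_comm]
  exact h

/-- Completing the square gives (exp(t/τ) w²)' ≤ exp(t/τ) f²/τ. Integrating the bound on f² costs
1/(1 - μτ), at most 3 when μτ ≤ 2/3. -/
theorem sq_le_of_relaxation {w w' f : ℝ → ℝ} {τ μ F : ℝ} (hτ : 0 < τ) (hμ : μ ≤ 2 / (3 * τ))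
    (hw : ∀ t, HasDerivAt w (w' t) t) (hw' : ∀ t, τ * w' t = f t - w t)
    (hF : ∀ t, 0 ≤ t → f t ^ 2 ≤ F * Real.exp (-μ * t)) (t : ℝ) (ht : 0 ≤ t) :
    w t ^ 2 ≤ Real.exp (-t / τ) * w 0 ^ 2 + 3 * F * Real.exp (-μ * t) := by
  have hF0 : 0 ≤ F := by
    have := hF 0 le_rfl
    simp only [mul_zero, Real.exp_zero, mul_one] at this
    exact (sq_nonneg _).trans this
  have hd : ∀ t, HasDerivAt
      (fun t => Real.exp (t / τ) * w t ^ 2 - 3 * F * Real.exp ((1 / τ - μ) * t))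
      (Real.exp (t / τ) * (w t ^ 2 / τ + 2 * w t * w' t) -
        3 * F * ((1 / τ - μ) * Real.exp ((1 / τ - μ) * t))) t := by
    intro t
    have h1 : HasDerivAt (fun t : ℝ => t / τ) (1 / τ) t := (hasDerivAt_id t).div_const τ
    have h2 : HasDerivAt (fun t : ℝ => (1 / τ - μ) * t) (1 / τ - μ) t := by
      simpa using (hasDerivAt_id t).const_mul (1 / τ - μ)
    convert! ((h1.exp).mul ((hw t).pow 2)).sub ((h2.exp).const_mul (3 * F)) using 1
    simp
    ring
  have hanti : AntitoneOn
      (fun t => Real.exp (t / τ) * w t ^ 2 - 3 * F * Real.exp ((1 / τ - μ) * t)) (Set.Ici 0) := by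
    refine antitoneOn_of_hasDerivWithinAt_nonpos (convex_Ici 0)
      (fun t _ => (hd t).continuousAt.continuousWithinAt)
      (fun t _ => (hd t).hasDerivWithinAt) fun t ht => ?_
    have ht0 : 0 ≤ t := interior_subset ht
    have h1 : w t ^ 2 / τ + 2 * w t * w' t ≤ f t ^ 2 / τ := by
      rw [show w' t = (f t - w t) / τ by rw [← hw']; field_simp, ← sub_nonneg]
      have : f t ^ 2 / τ - (w t ^ 2 / τ + 2 * w t * ((f t - w t) / τ)) = (f t - w t) ^ 2 / τ := by
        field_simp; ring
      rw [this]; positivity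
    have h2 : Real.exp ((1 / τ - μ) * t) = Real.exp (t / τ) * Real.exp (-μ * t) := by
      rw [← Real.exp_add]; congr 1; ring
    have h3 : 1 / (3 * τ) ≤ 1 / τ - μ := by
      have : 1 / (3 * τ) = 1 / τ - 2 / (3 * τ) := by field_simp; norm_num
      linarith
    have h4 : f t ^ 2 / τ ≤ 3 * F * ((1 / τ - μ) * Real.exp (-μ * t)) := by
      calc f t ^ 2 / τ ≤ F * Real.exp (-μ * t) / τ := by gcongr; exact hF t ht0
        _ = 3 * F * ((1 / (3 * τ)) * Real.exp (-μ * t)) := by field_simp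
        _ ≤ _ := by gcongr
    rw [h2]
    have h5 := mul_le_mul_of_nonneg_left (h1.trans h4) (Real.exp_pos (t / τ)).le
    linarith
  have h := hanti (Set.mem_Ici.2 le_rfl) (Set.mem_Ici.2 ht) ht
  simp only [zero_div, Real.exp_zero, one_mul, mul_zero, mul_one] at h
  have h2 : Real.exp ((1 / τ - μ) * t) = Real.exp (t / τ) * Real.exp (-μ * t) := by
    rw [← Real.exp_add]; congr 1; ring
  rw [h2] at h
  have h3 : Real.exp (-t / τ) * Real.exp (t / τ) = 1 := by
    rw [← Real.exp_add]; simp [neg_div]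
  have h4 := mul_le_mul_of_nonneg_left h (Real.exp_pos (-t / τ)).le
  have h5 : Real.exp (-t / τ) * (Real.exp (t / τ) * w t ^ 2 -
      3 * F * (Real.exp (t / τ) * Real.exp (-μ * t))) =
      (Real.exp (-t / τ) * Real.exp (t / τ)) * (w t ^ 2 - 3 * F * Real.exp (-μ * t)) := by ring
  rw [h5, h3] at h4
  have h6 : Real.exp (-t / τ) * (w 0 ^ 2 - 3 * F) ≤ Real.exp (-t / τ) * w 0 ^ 2 := by
    gcongr; linarith
  linarith

/-- Decay of `w = u_tt` for the equation at a fixed frequency `√κ`, real valued solutions. -/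
theorem exists_freq_decay_real {τ β : ℝ} (hτ : 0 < τ) (hτβ : τ < β) :
    ∃ C c : ℝ, 0 < C ∧ 0 < c ∧ ∀ (κ : ℝ), 0 ≤ κ → ∀ (u v w w' : ℝ → ℝ),
      (∀ t, HasDerivAt u (v t) t) → (∀ t, HasDerivAt v (w t) t) → (∀ t, HasDerivAt w (w' t) t) →
      (∀ t, τ * w' t = -(κ * (u t + β * v t)) - w t) → ∀ t, 0 ≤ t →
      w t ^ 2 ≤ Real.exp (-t / τ) * w 0 ^ 2 + C * κ * Real.exp (-(c * (κ / (1 + κ))) * t) *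
        ((v 0 + τ * w 0) ^ 2 + κ * (u 0 + τ * v 0) ^ 2 + κ * v 0 ^ 2) := by
  obtain ⟨γ, hγdef⟩ : ∃ γ, γ = β - τ := ⟨_, rfl⟩
  have hγ : 0 < γ := by linarith
  obtain ⟨D, hDdef⟩ : ∃ D, D = (2 * τ - γ) ^ 2 / 2 + 2 * τ * γ + 2 := ⟨_, rfl⟩
  have hD : 0 < D := by rw [hDdef]; positivity
  -- The three bounds on δ serve, in order, the remainder in the dissipation, the (p, a) part of the
  -- cross term, and its v part.
  obtain ⟨δ, hδdef⟩ : ∃ δ, δ = min (γ / D) (min (1 / (1 + 2 * τ)) (γ / 2)) := ⟨_, rfl⟩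
  have hδ : 0 < δ := by rw [hδdef]; positivity
  have hδ3 : δ * D ≤ γ := by
    rw [← le_div_iff₀ hD, hδdef]; exact min_le_left _ _
  have hδ1 : δ * (1 / 2 + τ) ≤ 1 / 2 := by
    have : δ ≤ 1 / (1 + 2 * τ) := by
      rw [hδdef]; exact (min_le_right _ _).trans (min_le_left _ _)
    rw [le_div_iff₀ (by positivity)] at this
    linarith
  have hδ2 : δ ≤ γ / 2 := by rw [hδdef]; exact (min_le_right _ _).trans (min_le_right _ _)
  -- δ/2 matches the damping of p and a, and 1/τ that of v; c₀ ≤ 1/τ also ensures μ ≤ 2/(3τ) in the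
  -- relaxation step.
  obtain ⟨c₀, hc₀def⟩ : ∃ c₀, c₀ = min (δ / 2) (1 / τ) := ⟨_, rfl⟩
  have hc₀ : 0 < c₀ := by rw [hc₀def]; positivity
  have hc₀δ : c₀ ≤ δ / 2 := by rw [hc₀def]; exact min_le_left _ _
  have hc₀τ : c₀ ≤ 1 / τ := by rw [hc₀def]; exact min_le_right _ _
  have hc₀τ' : c₀ * τ ≤ 1 := by rwa [← le_div_iff₀ hτ]
  obtain ⟨m, hmdef⟩ : ∃ m, m = 1 + γ / τ := ⟨_, rfl⟩
  have hm : 0 < m := by rw [hmdef]; positivity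
  obtain ⟨m', hm'def⟩ : ∃ m', m' = 1 + γ * τ := ⟨_, rfl⟩
  have hm' : 0 < m' := by rw [hm'def]; positivity
  -- The 3 comes from the relaxation; `m` bounds κ(a² + γ²v²) by the energy and `m'` the initial
  -- energy by the data. The 4 joins (x + y)² ≤ 2(x² + y²) to `En ≤ 2 * Ly`; 3/2 and 2/3 come from
  -- `Ly ≤ 3 / 2 * En`.
  refine ⟨3 * (4 * m * (3 / 2 * m')), 2 / 3 * c₀, by positivity, by positivity, ?_⟩
  intro κ hκ u v w w' hu hv hw hw'
  obtain ⟨ρ, hρdef⟩ : ∃ ρ, ρ = κ / (1 + κ) := ⟨_, rfl⟩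
  have hρ0 : 0 ≤ ρ := by rw [hρdef]; positivity
  have hρ1 : ρ ≤ 1 := by rw [hρdef, div_le_one (by positivity)]; linarith
  have hρκ : ρ ≤ κ := by rw [hρdef]; exact div_le_self hκ (by linarith)
  rw [← hρdef]
  set a : ℝ → ℝ := fun t => u t + τ * v t with ha
  set p : ℝ → ℝ := fun t => v t + τ * w t with hp
  set En : ℝ → ℝ := fun t => p t ^ 2 + κ * a t ^ 2 + γ * τ * κ * v t ^ 2 with hEn
  set Ly : ℝ → ℝ := fun t => lyapunov τ γ δ κ ρ (p t) (a t) (v t) with hLy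
  have hequiv : ∀ t, En t ≤ 2 * Ly t ∧ Ly t ≤ 3 / 2 * En t := by
    intro t
    have := abs_le.1 (lyapunov_cross_term_le (γ := γ) hτ hδ hδ1 hδ2 hρ0 hρ1 hρκ (p t) (a t) (v t))
    simp only [hLy, hEn, lyapunov]
    constructor <;> linarith [this.1, this.2]
  have hda : ∀ t, HasDerivAt a (p t) t := fun t => (hu t).add ((hv t).const_mul τ)
  have hdp : ∀ t, HasDerivAt p (-(κ * (a t + γ * v t))) t := by
    intro t
    convert! (hv t).add ((hw t).const_mul τ) using 1
    rw [hw' t, ha, hγdef]; ring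
  have hdv : ∀ t, HasDerivAt v ((p t - v t) / τ) t := by
    intro t
    convert hv t using 1
    rw [hp]; field_simp; ring
  have hdL : ∀ t, HasDerivAt Ly (-2 * γ * κ * v t ^ 2 + δ * ρ * (-p t ^ 2 - κ * a t ^ 2 +
      (2 * τ - γ) * κ * (a t * v t) + 2 * τ * γ * κ * v t ^ 2 + 2 * (p t * v t))) t := by
    intro t
    have h1 := (((hdp t).pow 2).add (((hda t).pow 2).const_mul κ)).add
      (((hdv t).pow 2).const_mul (γ * τ * κ))
    have h2 := (((hdp t).mul (hda t)).sub (((hdp t).mul (hdv t)).const_mul (2 * τ))).const_mul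
      (δ * ρ)
    convert! h1.add h2 using 1
    simp
    field_simp
    ring
  have hLdecay : ∀ t, 0 ≤ t → Ly t ≤ Real.exp (-(2 / 3 * c₀ * ρ) * t) * Ly 0 := by
    refine le_exp_mul_of_deriv_le hdL fun t => ?_
    have h1 := lyapunov_dissipation hτ hγ hδ (by rw [← hDdef]; exact hδ3) hρ0 hρ1 hρκ
      (p t) (a t) (v t)
    refine h1.trans ?_
    have h2 := (hequiv t).2
    have h3 : c₀ * ρ * Ly t ≤ c₀ * ρ * (3 / 2 * En t) := by gcongr
    have h4 : c₀ * ρ * (p t ^ 2 + κ * a t ^ 2) ≤ δ / 2 * ρ * (p t ^ 2 + κ * a t ^ 2) := by gcongr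
    have h5 : (c₀ * τ) * ρ * (γ * κ * v t ^ 2) ≤ 1 * 1 * (γ * κ * v t ^ 2) := by gcongr
    simp only [hEn] at h3
    linarith
  set V0 : ℝ := p 0 ^ 2 + κ * a 0 ^ 2 + κ * v 0 ^ 2 with hV0
  have hE0 : En 0 ≤ m' * V0 := by
    have h1 : 0 ≤ γ * τ * (p 0 ^ 2 + κ * a 0 ^ 2) := by positivity
    have h2 : 0 ≤ κ * v 0 ^ 2 := by positivity
    simp only [hEn, hV0, hm'def]
    linarith
  have hf : ∀ t, 0 ≤ t → (-(κ * (a t + γ * v t))) ^ 2 ≤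
      (κ * (4 * m * (3 / 2 * m')) * V0) * Real.exp (-(2 / 3 * c₀ * ρ) * t) := by
    intro t ht
    have h1 : (a t + γ * v t) ^ 2 ≤ 2 * (a t ^ 2 + γ ^ 2 * v t ^ 2) := by
      nlinarith [sq_nonneg (a t - γ * v t)]
    have h2 : κ * (a t ^ 2 + γ ^ 2 * v t ^ 2) ≤ m * En t := by
      have e : m * En t - κ * (a t ^ 2 + γ ^ 2 * v t ^ 2) =
          m * p t ^ 2 + (γ / τ) * κ * a t ^ 2 + γ * τ * κ * v t ^ 2 := by
        simp only [hEn, hmdef]; field_simp; ring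
      have : 0 ≤ m * p t ^ 2 + (γ / τ) * κ * a t ^ 2 + γ * τ * κ * v t ^ 2 := by positivity
      linarith
    have h3 := (hequiv t).1
    have h4 := hLdecay t ht
    have h5 := (hequiv 0).2
    calc (-(κ * (a t + γ * v t))) ^ 2 = κ * (κ * (a t + γ * v t) ^ 2) := by ring
      _ ≤ κ * (κ * (2 * (a t ^ 2 + γ ^ 2 * v t ^ 2))) := by gcongr
      _ = 2 * κ * (κ * (a t ^ 2 + γ ^ 2 * v t ^ 2)) := by ring
      _ ≤ 2 * κ * (m * En t) := by gcongr
      _ ≤ 2 * κ * (m * (2 * (Real.exp (-(2 / 3 * c₀ * ρ) * t) * (3 / 2 * (m' * V0))))) := by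
          gcongr
          refine h3.trans ?_
          gcongr
          refine h4.trans ?_
          gcongr
          linarith
      _ = _ := by ring
  intro t ht
  have := sq_le_of_relaxation (μ := 2 / 3 * c₀ * ρ) hτ (by
      have h1 : c₀ * ρ ≤ 1 / τ * 1 := by gcongr
      have h2 : 2 / (3 * τ) = 2 / 3 * (1 / τ) := by field_simp
      rw [h2]; linarith) hw (f := fun t => -(κ * (a t + γ * v t)))
      (fun t => by rw [hw' t, ha, hγdef]; ring) hf t ht
  refine this.trans (le_of_eq ?_)
  rw [hV0]
  ring

/-- The coefficients are real, so real and imaginary parts solve the equation separately. -/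
theorem exists_freq_decay {τ β : ℝ} (hτ : 0 < τ) (hτβ : τ < β) :
    ∃ C c : ℝ, 0 < C ∧ 0 < c ∧ ∀ (κ : ℝ), 0 ≤ κ → ∀ (u v w w' : ℝ → ℂ),
      (∀ t, HasDerivAt u (v t) t) → (∀ t, HasDerivAt v (w t) t) → (∀ t, HasDerivAt w (w' t) t) →
      (∀ t, τ * w' t = -(κ * (u t + β * v t)) - w t) → ∀ t, 0 ≤ t →
      ‖w t‖ ^ 2 ≤ Real.exp (-t / τ) * ‖w 0‖ ^ 2 + C * κ * Real.exp (-(c * (κ / (1 + κ))) * t) *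
        (‖v 0 + τ * w 0‖ ^ 2 + κ * ‖u 0 + τ * v 0‖ ^ 2 + κ * ‖v 0‖ ^ 2) := by
  obtain ⟨C, c, hC, hc, h⟩ := exists_freq_decay_real hτ hτβ
  refine ⟨C, c, hC, hc, fun κ hκ u v w w' hu hv hw hw' t ht => ?_⟩
  have hre : ∀ {f f' : ℝ → ℂ}, (∀ t, HasDerivAt f (f' t) t) →
      ∀ t, HasDerivAt (fun t => (f t).re) ((f' t).re) t := fun hf t =>
    Complex.reCLM.hasFDerivAt.comp_hasDerivAt t (hf t)
  have him : ∀ {f f' : ℝ → ℂ}, (∀ t, HasDerivAt f (f' t) t) →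
      ∀ t, HasDerivAt (fun t => (f t).im) ((f' t).im) t := fun hf t =>
    Complex.imCLM.hasFDerivAt.comp_hasDerivAt t (hf t)
  have h1 := h κ hκ _ _ _ _ (hre hu) (hre hv) (hre hw)
    (fun t => by simpa using congrArg Complex.re (hw' t)) t ht
  have h2 := h κ hκ _ _ _ _ (him hu) (him hv) (him hw)
    (fun t => by simpa using congrArg Complex.im (hw' t)) t ht
  simp only [Complex.sq_norm, Complex.normSq_apply, Complex.add_re, Complex.add_im,
    Complex.re_ofReal_mul, Complex.im_ofReal_mul]
  linarith

end Energy

/-! ### The flow of a frequency-dependent linear ODE on L² -/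

section Flow

open MeasureTheory

theorem continuous_exp_endomorphism {E : Type*} [NormedAddCommGroup E] [NormedSpace ℝ E]
    [CompleteSpace E] : Continuous (NormedSpace.exp : (E →L[ℝ] E) → (E →L[ℝ] E)) :=
  letI := NormedAlgebra.restrictScalars ℚ ℝ (E →L[ℝ] E)
  NormedSpace.exp_continuous

theorem exp_zero_smul_apply {E : Type*} [NormedAddCommGroup E] [NormedSpace ℝ E]
    (A : E →L[ℝ] E) (x : E) : NormedSpace.exp ((0 : ℝ) • A) x = x := by
  rw [zero_smul, NormedSpace.exp_zero, one_apply_eq_self]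

variable {n : ℕ} {E : Type*} [NormedAddCommGroup E] [NormedSpace ℝ E] [CompleteSpace E]

/-- The propagator is continuous in the frequency parameter, hence bounded on the compact range that
`κ` takes where the data do not vanish. -/
theorem memLp_flow {A : ℝ → E →L[ℝ] E} (hA : Continuous A) {κ : Rn n → ℝ} (hκ : Continuous κ)
    {M : ℝ} {X₀ : Rn n → E} (hX : MemLp X₀ 2) (hsupp : ∀ ξ, X₀ ξ ≠ 0 → |κ ξ| ≤ M) (t : ℝ) :
    MemLp (fun ξ => NormedSpace.exp (t • A (κ ξ)) (X₀ ξ)) 2 := by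
  have hcont : Continuous fun k : ℝ => NormedSpace.exp (t • A k) :=
    continuous_exp_endomorphism.comp (hA.const_smul t)
  obtain ⟨C, hC⟩ := (isCompact_Icc (a := -M) (b := M)).exists_bound_of_continuousOn
    hcont.continuousOn
  refine hX.of_le_mul (c := C) ?_ (.of_forall fun ξ => ?_)
  · exact isBoundedBilinearMap_apply.continuous.comp_aestronglyMeasurable
      ((hcont.comp hκ).aestronglyMeasurable.prodMk hX.1)
  · by_cases h : X₀ ξ = 0
    · simp [h]
    · exact (ContinuousLinearMap.le_opNorm _ _).trans
        (by gcongr; exact hC _ (abs_le.1 (hsupp ξ h)))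

/-- The weak time derivative of the flow of a family of linear equations, at bounded
frequencies. -/
theorem hasDerivAt_integral_flow [NormedSpace ℂ E] {A : ℝ → E →L[ℝ] E} (hA : Continuous A) {κ : Rn n → ℝ}
    (hκ : Continuous κ) {M : ℝ} {X₀ : Rn n → E} (hX : MemLp X₀ 2)
    (hsupp : ∀ ξ, X₀ ξ ≠ 0 → |κ ξ| ≤ M) (g : 𝓢(Rn n, ℂ)) (t : ℝ) :
    Integrable (fun ξ => g ξ • A (κ ξ) (NormedSpace.exp (t • A (κ ξ)) (X₀ ξ))) ∧
    HasDerivAt (fun t => ∫ ξ, g ξ • NormedSpace.exp (t • A (κ ξ)) (X₀ ξ))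
      (∫ ξ, g ξ • A (κ ξ) (NormedSpace.exp (t • A (κ ξ)) (X₀ ξ))) t := by
  have hcont : Continuous fun p : ℝ × ℝ => A p.2 * NormedSpace.exp (p.1 • A p.2) :=
    (hA.comp continuous_snd).mul
      (continuous_exp_endomorphism.comp (continuous_fst.smul (hA.comp continuous_snd)))
  -- Compactness in time and frequency together gives the dominating function for differentiation
  -- under the integral.
  obtain ⟨C, hC⟩ := ((isCompact_Icc (a := t - 1) (b := t + 1)).prod
    (isCompact_Icc (a := -M) (b := M))).exists_bound_of_continuousOn hcont.continuousOn
  have hg : MemLp (fun ξ => g ξ) 2 := g.memLp 2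
  have hint : ∀ {Y : Rn n → E}, MemLp Y 2 → Integrable (fun ξ => g ξ • Y ξ) := fun hY =>
    memLp_one_iff_integrable.1 (hY.smul (p := 2) hg)
  refine hasDerivAt_integral_of_dominated_loc_of_deriv_le (𝕜 := ℝ) (E := E)
    (F := fun t ξ => g ξ • NormedSpace.exp (t • A (κ ξ)) (X₀ ξ))
    (F' := fun t ξ => g ξ • A (κ ξ) (NormedSpace.exp (t • A (κ ξ)) (X₀ ξ)))
    (s := Set.Icc (t - 1) (t + 1)) (bound := fun ξ => C * ‖g ξ • X₀ ξ‖)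
    (Icc_mem_nhds (by linarith) (by linarith)) (.of_forall fun s => ?_) ?_ ?_
    (.of_forall fun ξ s hs => ?_) ?_ (.of_forall fun ξ s hs => ?_)
  · exact (hint (memLp_flow hA hκ hX hsupp s)).1
  · exact hint (memLp_flow hA hκ hX hsupp t)
  · exact g.continuous.aestronglyMeasurable.smul
      (isBoundedBilinearMap_apply.continuous.comp_aestronglyMeasurable
        ((hA.comp hκ).aestronglyMeasurable.prodMk (memLp_flow hA hκ hX hsupp t).1))
  · rw [norm_smul, norm_smul, mul_left_comm]
    gcongr
    by_cases h : X₀ ξ = 0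
    · simp [h]
    · exact ((A (κ ξ) * NormedSpace.exp (s • A (κ ξ))).le_opNorm _).trans
        (by gcongr; exact hC (s, κ ξ) ⟨hs, abs_le.1 (hsupp ξ h)⟩)
  · exact (hint hX).norm.const_mul C
  · have h1 : HasDerivAt (fun s : ℝ => NormedSpace.exp (s • A (κ ξ)) (X₀ ξ))
        (A (κ ξ) (NormedSpace.exp (s • A (κ ξ)) (X₀ ξ))) s := by
      simpa using (hasDerivAt_exp_smul_const' (𝕂 := ℝ) (A (κ ξ)) s).clm_apply
        (hasDerivAt_const s (X₀ ξ))
    exact h1.const_smul (g ξ)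

end Flow

/-! ### Identification of a localized solution with the flow -/

section Localized

open MeasureTheory

/-- The generator at frequency `√κ` of `u' = v`, `v' = w`, `τ w' = -κ (u + β v) - w`. -/
noncomputable def mgtGenerator (τ β κ : ℝ) : (ℂ × ℂ × ℂ) →L[ℝ] (ℂ × ℂ × ℂ) :=
  let pu := ContinuousLinearMap.fst ℝ ℂ (ℂ × ℂ)
  let pv := (ContinuousLinearMap.fst ℝ ℂ ℂ).comp (ContinuousLinearMap.snd ℝ ℂ (ℂ × ℂ))
  let pw := (ContinuousLinearMap.snd ℝ ℂ ℂ).comp (ContinuousLinearMap.snd ℝ ℂ (ℂ × ℂ))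
  pv.prod (pw.prod (-τ⁻¹ • pw)) +
    κ • (0 : (ℂ × ℂ × ℂ) →L[ℝ] ℂ).prod
      ((0 : (ℂ × ℂ × ℂ) →L[ℝ] ℂ).prod (-τ⁻¹ • (pu + β • pv)))

theorem continuous_mgtGenerator (τ β : ℝ) : Continuous (mgtGenerator τ β) := by
  unfold mgtGenerator
  fun_prop

theorem mgtGenerator_apply (τ β κ : ℝ) (x : ℂ × ℂ × ℂ) :
    mgtGenerator τ β κ x = (x.2.1, x.2.2, -(τ : ℂ)⁻¹ * (κ * (x.1 + β * x.2.1) + x.2.2)) := by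
  simp [mgtGenerator, Prod.ext_iff]
  ring

variable {n : ℕ}

theorem toTemperedDistribution_toLp_apply {F : Rn n → ℂ} (hF : MemLp F 2) (g : 𝓢(Rn n, ℂ)) :
    Lp.toTemperedDistribution (hF.toLp F) g = ∫ ξ, g ξ * F ξ := by
  rw [Lp.toTemperedDistribution_apply]
  refine integral_congr_ae ?_
  filter_upwards [hF.coeFn_toLp] with ξ h
  rw [h, smul_eq_mul]

theorem integrable_schwartz_mul {F : Rn n → ℂ} (hF : MemLp F 2) (g : 𝓢(Rn n, ℂ)) :
    Integrable fun ξ => g ξ * F ξ :=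
  memLp_one_iff_integrable.1 (hF.mul (p := 2) (g.memLp 2))

/-- A solution in the tempered distributions of the equation in frequency variables, whose data
are square integrable functions supported at bounded frequencies, is given by square integrable
functions which solve the equation at each frequency. -/
theorem exists_freq_solution {τ β : ℝ} (K : 𝓢(Rn n, ℂ)) {κ : Rn n → ℝ}
    (hκ : Continuous κ) {M : ℝ} {x y z : ℝ → 𝓢'(Rn n, ℂ)}
    (hx : ∀ g t, 0 ≤ t → HasDerivWithinAt (fun r => x r g) (y t g) (Set.Ici 0) t)
    (hy : ∀ g t, 0 ≤ t → HasDerivWithinAt (fun r => y r g) (z t g) (Set.Ici 0) t)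
    (hz : ∀ g t, 0 ≤ t → HasDerivWithinAt (fun r => z r g)
      (-(τ : ℂ)⁻¹ * (x t (SchwartzMap.smulLeftCLM ℂ K g) +
        β * y t (SchwartzMap.smulLeftCLM ℂ K g) + z t g)) (Set.Ici 0) t)
    {U V W : Rn n → ℂ} (hU : MemLp U 2) (hV : MemLp V 2) (hW : MemLp W 2)
    (hsupp : ∀ ξ, (U ξ, V ξ, W ξ) ≠ (0, 0, 0) → K ξ = κ ξ ∧ |κ ξ| ≤ M)
    (hx0 : x 0 = Lp.toTemperedDistribution (hU.toLp U))
    (hy0 : y 0 = Lp.toTemperedDistribution (hV.toLp V))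
    (hz0 : z 0 = Lp.toTemperedDistribution (hW.toLp W)) (t : ℝ) (ht : 0 ≤ t) :
    ∃ (Z : Rn n → ℂ) (hZ : MemLp Z 2), z t = Lp.toTemperedDistribution (hZ.toLp Z) ∧
      ∀ ξ, ∃ u v w w' : ℝ → ℂ, (∀ t, HasDerivAt u (v t) t) ∧ (∀ t, HasDerivAt v (w t) t) ∧
        (∀ t, HasDerivAt w (w' t) t) ∧
        (∀ t, w' t = -(τ : ℂ)⁻¹ * (κ ξ * (u t + β * v t) + w t)) ∧
        u 0 = U ξ ∧ v 0 = V ξ ∧ w 0 = W ξ ∧ w t = Z ξ := by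
  set A := mgtGenerator τ β with hAdef
  have hA : Continuous A := continuous_mgtGenerator τ β
  set X₀ : Rn n → ℂ × ℂ × ℂ := fun ξ => (U ξ, V ξ, W ξ) with hX₀
  have hX : MemLp X₀ 2 := .of_fst_snd ⟨hU, .of_fst_snd ⟨hV, hW⟩⟩
  have hs : ∀ ξ, X₀ ξ ≠ 0 → |κ ξ| ≤ M := fun ξ h => (hsupp ξ h).2
  set X : ℝ → Rn n → ℂ × ℂ × ℂ := fun t ξ => NormedSpace.exp (t • A (κ ξ)) (X₀ ξ) with hXdef
  have hXL : ∀ t, MemLp (X t) 2 := memLp_flow hA hκ hX hs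
  have hU' : ∀ t, MemLp (fun ξ => (X t ξ).1) 2 := fun t => (hXL t).fst
  have hV' : ∀ t, MemLp (fun ξ => (X t ξ).2.1) 2 := fun t => (hXL t).snd.fst
  have hW' : ∀ t, MemLp (fun ξ => (X t ξ).2.2) 2 := fun t => (hXL t).snd.snd
  have hX0 : ∀ ξ, X 0 ξ = X₀ ξ := fun ξ => exp_zero_smul_apply _ _
  have hXzero : ∀ t ξ, X₀ ξ = 0 → X t ξ = 0 := fun t ξ h => by simp [hXdef, h]
  have hXd : ∀ ξ t, HasDerivAt (fun t => X t ξ) (A (κ ξ) (X t ξ)) t := fun ξ t => by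
    simpa using (hasDerivAt_exp_smul_const' (𝕂 := ℝ) (A (κ ξ)) t).clm_apply
      (hasDerivAt_const t (X₀ ξ))
  let pu := ContinuousLinearMap.fst ℝ ℂ (ℂ × ℂ)
  let pv := (ContinuousLinearMap.fst ℝ ℂ ℂ).comp (ContinuousLinearMap.snd ℝ ℂ (ℂ × ℂ))
  let pw := (ContinuousLinearMap.snd ℝ ℂ ℂ).comp (ContinuousLinearMap.snd ℝ ℂ (ℂ × ℂ))
  have hcomp : ∀ (p : (ℂ × ℂ × ℂ) →L[ℝ] ℂ), (∀ (c : ℂ) a, p (c • a) = c * p a) →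
      ∀ (g : 𝓢(Rn n, ℂ)) t, HasDerivAt (fun t => ∫ ξ, g ξ * p (X t ξ))
        (∫ ξ, g ξ * p (A (κ ξ) (X t ξ))) t := by
    intro p hp g t
    obtain ⟨h1, h2⟩ := hasDerivAt_integral_flow hA hκ hX hs g t
    have h3 := p.hasFDerivAt.comp_hasDerivAt t h2
    have h4 : ∀ t, Integrable fun ξ => g ξ • X t ξ := fun t =>
      memLp_one_iff_integrable.1 ((hXL t).smul (p := 2) (g.memLp 2))
    rw [← ContinuousLinearMap.integral_comp_comm p h1] at h3
    simp only [hp] at h3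
    refine h3.congr_of_eventuallyEq (.of_forall fun s => ?_)
    simp only [Function.comp_apply]
    rw [← ContinuousLinearMap.integral_comp_comm p (h4 s)]
    simp only [hp]
  have hdu : ∀ (g : 𝓢(Rn n, ℂ)) t, HasDerivAt (fun t => ∫ ξ, g ξ * (X t ξ).1)
      (∫ ξ, g ξ * (X t ξ).2.1) t := fun g t => by
    have := hcomp pu (fun c a => by simp [pu]) g t
    simpa [pu, hAdef, mgtGenerator_apply] using this
  have hdv : ∀ (g : 𝓢(Rn n, ℂ)) t, HasDerivAt (fun t => ∫ ξ, g ξ * (X t ξ).2.1)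
      (∫ ξ, g ξ * (X t ξ).2.2) t := fun g t => by
    have := hcomp pv (fun c a => by simp [pv]) g t
    simpa [pv, hAdef, mgtGenerator_apply] using this
  have hdw : ∀ (g : 𝓢(Rn n, ℂ)) t, HasDerivAt (fun t => ∫ ξ, g ξ * (X t ξ).2.2)
      (-(τ : ℂ)⁻¹ * ((∫ ξ, SchwartzMap.smulLeftCLM ℂ K g ξ * (X t ξ).1) +
        β * (∫ ξ, SchwartzMap.smulLeftCLM ℂ K g ξ * (X t ξ).2.1) +
        ∫ ξ, g ξ * (X t ξ).2.2)) t := fun g t => by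
    have := hcomp pw (fun c a => by simp [pw]) g t
    refine this.congr_deriv (Eq.symm ?_)
    set Kg := SchwartzMap.smulLeftCLM ℂ K g
    have i1 := integrable_schwartz_mul (hU' t) Kg
    have i2 := (integrable_schwartz_mul (hV' t) Kg).const_mul (β : ℂ)
    have i3 := integrable_schwartz_mul (hW' t) g
    have i4 : Integrable fun ξ => Kg ξ * (X t ξ).1 + β * (Kg ξ * (X t ξ).2.1) := i1.add i2
    rw [← integral_const_mul, ← integral_add i1 i2, ← integral_add i4 i3, ← integral_const_mul]
    refine integral_congr_ae (.of_forall fun ξ => ?_)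
    simp only [hAdef, mgtGenerator_apply, pw, ContinuousLinearMap.comp_apply,
      ContinuousLinearMap.coe_snd']
    -- Where the data vanish so does the flow, so `K` and `κ` need to agree only elsewhere.
    by_cases h : X₀ ξ = 0
    · simp [hXzero t ξ h]
    · have hK : K ξ = κ ξ := (hsupp ξ h).1
      have : Kg ξ = κ ξ * g ξ := by
        simp [Kg, SchwartzMap.smulLeftCLM_apply_apply K.hasTemperateGrowth, hK]
      rw [this]
      ring
  -- The given solution minus the flow has zero data and solves the system with the Schwartz symbol
  -- `K`.
  have hzero := TemperedDistribution.eq_zero_of_hasDerivWithinAt K (-τ⁻¹) (-τ⁻¹ * β) (-τ⁻¹)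
    (x := fun t => x t - Lp.toTemperedDistribution ((hU' t).toLp _))
    (y := fun t => y t - Lp.toTemperedDistribution ((hV' t).toLp _))
    (z := fun t => z t - Lp.toTemperedDistribution ((hW' t).toLp _))
    (fun g t ht => by
      simp only [sub_apply, toTemperedDistribution_toLp_apply]
      exact (hx g t ht).sub (hdu g t).hasDerivWithinAt)
    (fun g t ht => by
      simp only [sub_apply, toTemperedDistribution_toLp_apply]
      exact (hy g t ht).sub (hdv g t).hasDerivWithinAt)
    (fun g t ht => by
      have := (hz g t ht).sub (hdw g t).hasDerivWithinAt
      simp only [sub_apply, toTemperedDistribution_toLp_apply]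
      convert! this using 1
      push_cast
      ring)
    (by simp [hx0, hX0, hX₀]) (by simp [hy0, hX0, hX₀]) (by simp [hz0, hX0, hX₀]) t ht
  refine ⟨fun ξ => (X t ξ).2.2, hW' t, sub_eq_zero.1 hzero, fun ξ =>
    ⟨fun t => (X t ξ).1, fun t => (X t ξ).2.1, fun t => (X t ξ).2.2,
      fun t => (A (κ ξ) (X t ξ)).2.2, fun t => ?_, fun t => ?_, fun t => ?_, fun t => ?_,
      by simp [hX0, hX₀], by simp [hX0, hX₀], by simp [hX0, hX₀], rfl⟩⟩
  · have := pu.hasFDerivAt.comp_hasDerivAt t (hXd ξ t)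
    simpa [pu, hAdef, mgtGenerator_apply, Function.comp_def] using this
  · have := pv.hasFDerivAt.comp_hasDerivAt t (hXd ξ t)
    simpa [pv, hAdef, mgtGenerator_apply, Function.comp_def] using this
  · have := pw.hasFDerivAt.comp_hasDerivAt t (hXd ξ t)
    simpa [pw, Function.comp_def] using this
  · simp [hAdef, mgtGenerator_apply]

end Localized

/-! ### Dyadic blocks in frequency variables -/

section FrequencySide

open MeasureTheory FourierTransform

variable {n : ℕ}

theorem toTemperedDistribution_injective :
    Function.Injective (Lp.toTemperedDistribution : Lp ℂ 2 (volume : Measure (Rn n)) → _) :=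
  LinearMap.ker_eq_bot.1 (Lp.ker_toTemperedDistributionCLM_eq_bot (F := ℂ)
    (μ := (volume : Measure (Rn n))) (p := 2))

theorem distLpNorm_fourierInv_le {T : 𝓢'(Rn n, ℂ)} {F : Rn n → ℂ} (hF : MemLp F 2)
    (hT : T = Lp.toTemperedDistribution (hF.toLp F)) :
    distLpNorm 2 (𝓕⁻ T) ≤ eLpNorm F 2 := by
  have h1 : Lp.toTemperedDistribution (𝓕⁻ (hF.toLp F)) = 𝓕⁻ T := by
    rw [hT, Lp.fourierInv_toTemperedDistribution_eq]
  refine (iInf₂_le (𝓕⁻ (hF.toLp F)) h1).trans (le_of_eq ?_)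
  have h2 : ‖𝓕⁻ (hF.toLp F)‖ = ‖hF.toLp F‖ := by
    rw [← Lp.norm_fourier_eq, fourier_fourierInv_eq]
  rw [enorm_eq_iff_norm_eq.2 h2, Lp.enorm_toLp]

/-- Plancherel; the infimum in `distLpNorm` runs over a single function, because L² embeds
injectively into the tempered distributions. -/
theorem exists_eq_toTemperedDistribution {T : 𝓢'(Rn n, ℂ)} (hT : distLpNorm 2 (𝓕⁻ T) < ∞) :
    ∃ (F : Rn n → ℂ) (hF : MemLp F 2), T = Lp.toTemperedDistribution (hF.toLp F) ∧
      eLpNorm F 2 = distLpNorm 2 (𝓕⁻ T) := by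
  obtain ⟨g, hg⟩ := iInf_lt_iff.1 hT
  obtain ⟨hgT, -⟩ := iInf_lt_iff.1 hg
  have h0 : T = Lp.toTemperedDistribution (𝓕 g) := by
    rw [← Lp.fourier_toTemperedDistribution_eq, hgT, fourier_fourierInv_eq]
  refine ⟨(𝓕 g : Lp ℂ 2 (volume : Measure (Rn n))), Lp.memLp _, ?_, ?_⟩
  · rw [Lp.toLp_coeFn]; exact h0
  · rw [← Lp.enorm_def, enorm_eq_iff_norm_eq.2 (Lp.norm_fourier_eq g)]
    refine le_antisymm (le_iInf₂ fun g' hg' => ?_) (iInf₂_le g hgT)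
    rw [toTemperedDistribution_injective (hgT.trans hg'.symm)]

theorem smulLeftCLM_toTemperedDistribution {h F : Rn n → ℂ} (hh : h.HasTemperateGrowth)
    (hF : MemLp F 2) (hhF : MemLp (fun ξ => h ξ * F ξ) 2) :
    TemperedDistribution.smulLeftCLM ℂ h (Lp.toTemperedDistribution (hF.toLp F)) =
      Lp.toTemperedDistribution (hhF.toLp _) := by
  ext g
  rw [TemperedDistribution.smulLeftCLM_apply_apply, toTemperedDistribution_toLp_apply,
    toTemperedDistribution_toLp_apply]
  refine integral_congr_ae (.of_forall fun ξ => ?_)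
  simp only [SchwartzMap.smulLeftCLM_apply_apply hh, smul_eq_mul]
  ring

theorem hasCompactSupport_of_norm_le {F : Type*} [Zero F] {f : Rn n → F} {R : ℝ}
    (h : ∀ ξ, f ξ ≠ 0 → ‖ξ‖ ≤ R) :
    HasCompactSupport f :=
  HasCompactSupport.of_support_subset_isCompact (isCompact_closedBall (0 : Rn n) R)
    fun ξ hξ => by simpa using h ξ hξ

/-- The symbol of the dyadic block `Δ̇_q` for Mathlib's normalization of the Fourier transform. -/
noncomputable def LittlewoodPaley.symbol (P : LittlewoodPaley n) (q : ℤ) (ξ : Rn n) : ℂ :=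
  ((P.φ ((2 : ℝ) ^ (-q) • (2 * Real.pi) • ξ) : ℝ) : ℂ)

/-- The Fourier transform of the dyadic block of a distribution. -/
noncomputable def LittlewoodPaley.freqBlock (P : LittlewoodPaley n) (q : ℤ) (f : 𝓢'(Rn n, ℂ)) :
    𝓢'(Rn n, ℂ) :=
  TemperedDistribution.smulLeftCLM ℂ (P.symbol q) (𝓕 f)

theorem LittlewoodPaley.block_eq (P : LittlewoodPaley n) (q : ℤ) (f : 𝓢'(Rn n, ℂ)) :
    P.block q f = 𝓕⁻ (P.freqBlock q f) := rfl

theorem LittlewoodPaley.freqBlock_add (P : LittlewoodPaley n) (q : ℤ) (f g : 𝓢'(Rn n, ℂ)) :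
    P.freqBlock q (f + g) = P.freqBlock q f + P.freqBlock q g := by
  simp [freqBlock, FourierTransform.fourier_add]

theorem LittlewoodPaley.freqBlock_smul (P : LittlewoodPaley n) (q : ℤ) (c : ℂ)
    (f : 𝓢'(Rn n, ℂ)) : P.freqBlock q (c • f) = c • P.freqBlock q f := by
  simp [freqBlock, FourierTransform.fourier_smul]

theorem LittlewoodPaley.freqBlock_apply (P : LittlewoodPaley n) (q : ℤ) (f : 𝓢'(Rn n, ℂ))
    (g : 𝓢(Rn n, ℂ)) :
    P.freqBlock q f g = f (𝓕 (SchwartzMap.smulLeftCLM ℂ (P.symbol q) g)) := rfl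

theorem LittlewoodPaley.symbol_support (P : LittlewoodPaley n) (q : ℤ) (ξ : Rn n)
    (h : P.symbol q ξ ≠ 0) :
    3 / 4 * (2 : ℝ) ^ q ≤ 2 * Real.pi * ‖ξ‖ ∧ 2 * Real.pi * ‖ξ‖ ≤ 8 / 3 * (2 : ℝ) ^ q := by
  have h1 : P.φ ((2 : ℝ) ^ (-q) • (2 * Real.pi) • ξ) ≠ 0 := by
    simpa [symbol] using h
  have h2 := P.support_subset h1
  have hpos : (0 : ℝ) < 2 ^ q := by positivity
  have h3 : ‖(2 : ℝ) ^ (-q) • (2 * Real.pi) • ξ‖ = (2 * Real.pi * ‖ξ‖) / 2 ^ q := by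
    rw [norm_smul, norm_smul, zpow_neg, Real.norm_of_nonneg (by positivity),
      Real.norm_of_nonneg (by positivity)]
    ring
  rw [Set.mem_ofPred_eq, h3, le_div_iff₀ hpos, div_le_iff₀ hpos] at h2
  exact h2

theorem LittlewoodPaley.hasTemperateGrowth_symbol (P : LittlewoodPaley n) (q : ℤ) :
    (P.symbol q).HasTemperateGrowth := by
  refine HasCompactSupport.hasTemperateGrowth
    (hasCompactSupport_of_norm_le (R := 8 / 3 * (2 : ℝ) ^ q / (2 * Real.pi)) fun ξ hξ => ?_) ?_
  · rw [le_div_iff₀ (by positivity)]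
    linarith [(P.symbol_support q ξ hξ).2]
  · unfold symbol
    exact Complex.ofRealCLM.contDiff.comp (P.smooth.comp
      ((contDiff_id.const_smul _).const_smul _))

/-- For r = 2^q the cutoff is 1 on the support of the symbol of the block. Multiplying by it makes
the support of L² representatives, known only almost everywhere, hold at every point; vanishing near
0, it permits division by ‖ξ‖². -/
theorem exists_annulus_cutoff (n : ℕ) {r : ℝ} (hr : 0 < r) :
    ∃ χ : Rn n → ℝ, ContDiff ℝ (⊤ : ℕ∞) χ ∧ (∀ ξ, χ ξ ∈ Set.Icc (0 : ℝ) 1) ∧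
      (∀ ξ, 3 / 4 * r ≤ 2 * Real.pi * ‖ξ‖ → 2 * Real.pi * ‖ξ‖ ≤ 8 / 3 * r → χ ξ = 1) ∧
      (∀ ξ, χ ξ ≠ 0 → 3 / 8 * r ≤ 2 * Real.pi * ‖ξ‖ ∧ 2 * Real.pi * ‖ξ‖ ≤ 16 / 3 * r) := by
  have hπ := Real.pi_pos
  let b₁ : ContDiffBump (0 : Rn n) :=
    ⟨8 / 3 * r / (2 * Real.pi), 16 / 3 * r / (2 * Real.pi), by positivity, by gcongr; norm_num⟩
  let b₀ : ContDiffBump (0 : Rn n) :=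
    ⟨3 / 8 * r / (2 * Real.pi), 3 / 4 * r / (2 * Real.pi), by positivity, by gcongr; norm_num⟩
  refine ⟨fun ξ => b₁ ξ * (1 - b₀ ξ), b₁.contDiff.mul (contDiff_const.sub b₀.contDiff),
    fun ξ => ⟨mul_nonneg b₁.nonneg (sub_nonneg.2 b₀.le_one),
      mul_le_one₀ b₁.le_one (sub_nonneg.2 b₀.le_one) (sub_le_self _ b₀.nonneg)⟩,
    fun ξ h1 h2 => ?_, fun ξ h => ⟨?_, ?_⟩⟩
  · have e1 : b₁ ξ = 1 := b₁.one_of_mem_closedBall (by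
      rw [mem_closedBall_zero_iff, le_div_iff₀ (by positivity)]; linarith)
    have e0 : b₀ ξ = 0 := b₀.zero_of_le_dist (by
      rw [dist_zero_right, div_le_iff₀ (by positivity)]; linarith)
    simp [e1, e0]
  · by_contra hlt
    have e0 : b₀ ξ = 1 := b₀.one_of_mem_closedBall (by
      rw [mem_closedBall_zero_iff, le_div_iff₀ (by positivity)]; linarith)
    exact h (by simp [e0])
  · by_contra hlt
    have e1 : b₁ ξ = 0 := b₁.zero_of_le_dist (by
      rw [dist_zero_right, div_le_iff₀ (by positivity)]; linarith)
    exact h (by simp [e1])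

/-- A Schwartz substitute for the symbol of -Δ, exact on the support of the annulus cutoff, to which
the uniqueness theorem applies. -/
theorem exists_laplacian_cutoff (n : ℕ) {r : ℝ} (hr : 0 < r) :
    ∃ K : 𝓢(Rn n, ℂ), ∀ ξ, 2 * Real.pi * ‖ξ‖ ≤ 16 / 3 * r →
      K ξ = (((2 * Real.pi * ‖ξ‖) ^ 2 : ℝ) : ℂ) := by
  have hπ := Real.pi_pos
  let b : ContDiffBump (0 : Rn n) :=
    ⟨16 / 3 * r / (2 * Real.pi), 17 / 3 * r / (2 * Real.pi), by positivity, by gcongr; norm_num⟩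
  have hc : HasCompactSupport fun ξ : Rn n =>
      ((b ξ * ((2 * Real.pi) ^ 2 * ‖ξ‖ ^ 2) : ℝ) : ℂ) := by
    refine hasCompactSupport_of_norm_le (R := b.rOut) fun ξ h => ?_
    by_contra hlt
    have e : b ξ = 0 := b.zero_of_le_dist (by rw [dist_zero_right]; linarith)
    exact h (by simp [e])
  refine ⟨hc.toSchwartzMap (Complex.ofRealCLM.contDiff.comp
    (b.contDiff.mul (contDiff_const.mul (contDiff_norm_sq ℝ)))), fun ξ h => ?_⟩
  have e : b ξ = 1 := b.one_of_mem_closedBall (by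
      rw [mem_closedBall_zero_iff, le_div_iff₀ (by positivity)]; linarith)
  change ((b ξ * ((2 * Real.pi) ^ 2 * ‖ξ‖ ^ 2) : ℝ) : ℂ) = _
  rw [e, one_mul, ← mul_pow]

theorem LittlewoodPaley.freqBlock_laplacian (P : LittlewoodPaley n) (q : ℤ) {K : 𝓢(Rn n, ℂ)}
    (hK : ∀ ξ, P.symbol q ξ ≠ 0 → K ξ = (((2 * Real.pi * ‖ξ‖) ^ 2 : ℝ) : ℂ))
    (f : 𝓢'(Rn n, ℂ)) (g : 𝓢(Rn n, ℂ)) :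
    P.freqBlock q (Δ f) g = -P.freqBlock q f (SchwartzMap.smulLeftCLM ℂ K g) := by
  have htg : (fun ξ : Rn n => Complex.ofReal (‖ξ‖ ^ 2)).HasTemperateGrowth := by fun_prop
  have hm := P.hasTemperateGrowth_symbol q
  have h1 : 𝓕 (Δ f) = -(2 * Real.pi) ^ 2 •
      TemperedDistribution.smulLeftCLM ℂ (fun ξ : Rn n => Complex.ofReal (‖ξ‖ ^ 2)) (𝓕 f) := by
    rw [TemperedDistribution.laplacian_eq_fourierMultiplierCLM,
      TemperedDistribution.fourierMultiplierCLM_apply, ← Complex.coe_smul,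
      FourierTransform.fourier_smul, fourier_fourierInv_eq]
    rfl
  rw [freqBlock, freqBlock, h1, TemperedDistribution.smulLeftCLM_apply_apply,
    TemperedDistribution.smulLeftCLM_apply_apply, smul_apply,
    TemperedDistribution.smulLeftCLM_apply_apply, ← map_neg, ← Complex.coe_smul, ← map_smul]
  congr 1
  ext ξ
  simp only [smul_apply, neg_apply,
    SchwartzMap.smulLeftCLM_apply_apply htg, SchwartzMap.smulLeftCLM_apply_apply hm,
    SchwartzMap.smulLeftCLM_apply_apply K.hasTemperateGrowth, smul_eq_mul]
  by_cases h : P.symbol q ξ = 0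
  · simp [h]
  · rw [hK ξ h]; push_cast; ring

/-- If the gradient of `f` is square integrable on a dyadic block, then so is `f`, with the
pointwise control in frequency. -/
theorem LittlewoodPaley.exists_freqBlock_of_gradient (P : LittlewoodPaley n) (q : ℤ)
    {χ : Rn n → ℝ} (hχs : ContDiff ℝ (⊤ : ℕ∞) χ) (hχ01 : ∀ ξ, χ ξ ∈ Set.Icc (0 : ℝ) 1)
    (hχ1 : ∀ ξ, P.symbol q ξ ≠ 0 → χ ξ = 1) {r R : ℝ} (hr : 0 < r)
    (hχ0 : ∀ ξ, χ ξ ≠ 0 → r ≤ ‖ξ‖ ∧ ‖ξ‖ ≤ R)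
    (f : 𝓢'(Rn n, ℂ)) {G : Fin n → Rn n → ℂ} (hG : ∀ i, MemLp (G i) 2)
    (hfG : ∀ i, P.freqBlock q (pderivDist i f) = Lp.toTemperedDistribution ((hG i).toLp _)) :
    ∃ (A : Rn n → ℂ) (hA : MemLp A 2), P.freqBlock q f = Lp.toTemperedDistribution (hA.toLp _) ∧
      (∀ ξ, A ξ ≠ 0 → χ ξ ≠ 0) ∧ ∀ ξ, 2 * Real.pi * ‖ξ‖ * ‖A ξ‖ ≤ ∑ i, ‖G i ξ‖ := by
  have hπ := Real.pi_pos
  have hm := P.hasTemperateGrowth_symbol q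
  set d : Rn n → ℝ := fun ξ => χ ξ / ‖ξ‖ ^ 2 with hd
  have hds : ContDiff ℝ (⊤ : ℕ∞) d := by
    rw [contDiff_iff_contDiffAt]
    intro ξ
    by_cases h : ξ = 0
    · have : d =ᶠ[nhds ξ] fun _ => 0 := by
        filter_upwards [Metric.ball_mem_nhds ξ hr] with η hη
        rw [h, mem_ball_zero_iff] at hη
        have : χ η = 0 := by
          by_contra hne
          linarith [(hχ0 η hne).1]
        simp [hd, this]
      exact contDiffAt_const.congr_of_eventuallyEq this
    · exact hχs.contDiffAt.div (contDiff_norm_sq ℝ).contDiffAt (by simpa using h)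
  set c : ℂ := 2 * Real.pi * Complex.I with hc
  have hc0 : c ≠ 0 := by simp [hc, hπ.ne']
  have hcn : ‖c‖ = 2 * Real.pi := by simp [hc, abs_of_pos hπ]
  -- Since ∂ᵢ has symbol c ξᵢ and ∑ ξᵢ² = ‖ξ‖², the multipliers `h i` recover the block of `f` from
  -- those of its partial derivatives.
  set h : Fin n → Rn n → ℂ := fun i ξ => c⁻¹ * ((d ξ * ξ i : ℝ) : ℂ) with hh
  have hcoord : ∀ i, ContDiff ℝ (⊤ : ℕ∞) fun ξ : Rn n => ξ i := fun i =>
    (EuclideanSpace.proj (𝕜 := ℝ) i).contDiff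
  have hhs : ∀ i, ContDiff ℝ (⊤ : ℕ∞) (h i) := fun i =>
    contDiff_const.mul (Complex.ofRealCLM.contDiff.comp (hds.mul (hcoord i)))
  have hhg : ∀ i, (h i).HasTemperateGrowth := fun i =>
    HasCompactSupport.hasTemperateGrowth (hasCompactSupport_of_norm_le (R := R) fun ξ hξ =>
      (hχ0 ξ fun h0 => hξ (by simp [hh, hd, h0])).2) (hhs i)
  have hhn : ∀ i ξ, 2 * Real.pi * ‖ξ‖ * ‖h i ξ‖ ≤ 1 := by
    intro i ξ
    by_cases h0 : χ ξ = 0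
    · simp [hh, hd, h0]
    have hξ : 0 < ‖ξ‖ := hr.trans_le (hχ0 ξ h0).1
    have e : 2 * Real.pi * ‖ξ‖ * ‖h i ξ‖ = χ ξ * (|ξ i| / ‖ξ‖) := by
      simp only [hh, hd, norm_mul, norm_inv, hcn, Complex.norm_real, norm_div, norm_pow,
        Real.norm_of_nonneg (hχ01 ξ).1, Real.norm_eq_abs, abs_norm]
      field_simp
    rw [e]
    refine mul_le_one₀ (hχ01 ξ).2 (by positivity) ((div_le_one hξ).2 ?_)
    simpa using PiLp.norm_apply_le ξ i
  have hhb : ∀ i ξ, ‖h i ξ‖ ≤ 1 / (2 * Real.pi * r) := by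
    intro i ξ
    by_cases h0 : χ ξ = 0
    · simp only [hh, hd, h0]; simp; positivity
    rw [le_div_iff₀ (by positivity)]
    refine le_trans ?_ (hhn i ξ)
    rw [mul_comm]
    gcongr
    exact (hχ0 ξ h0).1
  have hhG : ∀ i, MemLp (fun ξ => h i ξ * G i ξ) 2 := fun i =>
    (hG i).of_le_mul ((hhs i).continuous.aestronglyMeasurable.mul (hG i).1)
      (.of_forall fun ξ => by rw [norm_mul]; gcongr; exact hhb i ξ)
  have hA : MemLp (fun ξ => ∑ i, h i ξ * G i ξ) 2 := memLp_finsetSum _ fun i _ => hhG i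
  refine ⟨_, hA, ?_, fun ξ hξ h0 => hξ (by simp [hh, hd, h0]), fun ξ => ?_⟩
  · ext g
    have e1 : Lp.toTemperedDistribution (hA.toLp _) g =
        ∑ i, Lp.toTemperedDistribution ((hhG i).toLp _) g := by
      simp only [toTemperedDistribution_toLp_apply, Finset.mul_sum]
      exact integral_finsetSum _ fun i _ => integrable_schwartz_mul (hhG i) g
    rw [e1]
    have e2 : ∀ i, Lp.toTemperedDistribution ((hhG i).toLp _) g =
        𝓕 f (c • SchwartzMap.smulLeftCLM ℂ (fun ξ : Rn n => Complex.ofReal (ξ i))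
          (SchwartzMap.smulLeftCLM ℂ (P.symbol q) (SchwartzMap.smulLeftCLM ℂ (h i) g))) := by
      intro i
      rw [← smulLeftCLM_toTemperedDistribution (hhg i) (hG i) (hhG i), ← hfG i]
      rw [TemperedDistribution.smulLeftCLM_apply_apply, freqBlock,
        TemperedDistribution.smulLeftCLM_apply_apply, pderivDist,
        TemperedDistribution.fourier_lineDerivOp_eq, map_smul, smul_apply,
        TemperedDistribution.smulLeftCLM_apply_apply]
      simp [EuclideanSpace.inner_single_right, hc]
    simp only [e2, ← map_sum]
    rw [freqBlock, TemperedDistribution.smulLeftCLM_apply_apply]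
    congr 1
    ext ξ
    have htg : ∀ i, (fun ξ : Rn n => Complex.ofReal (ξ i)).HasTemperateGrowth := by
      intro i
      have := (Complex.ofRealCLM.comp (EuclideanSpace.proj i : Rn n →L[ℝ] ℝ)).hasTemperateGrowth
      exact this
    simp only [sum_apply, smul_apply, SchwartzMap.smulLeftCLM_apply_apply (htg _),
      SchwartzMap.smulLeftCLM_apply_apply hm, SchwartzMap.smulLeftCLM_apply_apply (hhg _),
      smul_eq_mul]
    by_cases h0 : P.symbol q ξ = 0
    · simp [h0]
    have h1 := hχ1 ξ h0
    have hξ : 0 < ‖ξ‖ := hr.trans_le (hχ0 ξ (by rw [h1]; norm_num)).1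
    have e3 : ∀ i, c * ((ξ i : ℂ) * (P.symbol q ξ * (h i ξ * g ξ))) =
        ((ξ i ^ 2 : ℝ) : ℂ) * ((‖ξ‖ ^ 2 : ℝ) : ℂ)⁻¹ * (P.symbol q ξ * g ξ) := by
      intro i
      simp only [hh, hd, h1]
      push_cast
      field_simp
    simp only [e3, ← Finset.sum_mul, ← Complex.ofReal_sum]
    have e4 : ∑ i, ξ i ^ 2 = ‖ξ‖ ^ 2 := by rw [EuclideanSpace.real_norm_sq_eq]
    rw [e4, mul_inv_cancel₀ (by exact_mod_cast (pow_pos hξ 2).ne'), one_mul]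
  · calc 2 * Real.pi * ‖ξ‖ * ‖∑ i, h i ξ * G i ξ‖
        ≤ 2 * Real.pi * ‖ξ‖ * ∑ i, ‖h i ξ * G i ξ‖ := by gcongr; exact norm_sum_le _ _
      _ = ∑ i, (2 * Real.pi * ‖ξ‖ * ‖h i ξ‖) * ‖G i ξ‖ := by
          rw [Finset.mul_sum]; exact Finset.sum_congr rfl fun i _ => by rw [norm_mul]; ring
      _ ≤ ∑ i, 1 * ‖G i ξ‖ := by gcongr with i; exact hhn i ξ
      _ = _ := by simp

end FrequencySide

/-! ### Decay of a single dyadic block -/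

section BlockDecay

open MeasureTheory FourierTransform

theorem le_add_of_sq_le_sq_add_sq {x a b : ℝ} (ha : 0 ≤ a) (hb : 0 ≤ b)
    (h : x ^ 2 ≤ a ^ 2 + b ^ 2) : x ≤ a + b :=
  le_of_sq_le_sq (h.trans (by nlinarith [mul_nonneg ha hb])) (add_nonneg ha hb)

/-- Lower bound for the dissipation rate `κ / (1 + κ)` on the annulus of size `r`. -/
theorem min_le_dissipation_rate {r k : ℝ} (hr : 0 < r) (hk : 3 / 8 * r ≤ k) :
    9 / 73 * min 1 (r ^ 2) ≤ k ^ 2 / (1 + k ^ 2) := by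
  set m := min 1 (r ^ 2) with hm
  have hm0 : 0 ≤ m := by positivity
  have hm1 : m ≤ 1 := min_le_left _ _
  have hk2 : 9 / 64 * m ≤ k ^ 2 := by
    have h1 : m ≤ r ^ 2 := min_le_right _ _
    have h2 : (3 / 8 * r) ^ 2 ≤ k ^ 2 := by gcongr
    nlinarith
  -- At x = 9m/64 the increasing function x/(1 + x) equals 9m/(64 + 9m), at least 9m/73 as m ≤ 1.
  rw [le_div_iff₀ (by positivity)]
  nlinarith

theorem toTemperedDistribution_toLp_congr {n : ℕ} {F G : Rn n → ℂ} (hF : MemLp F 2)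
    (hG : MemLp G 2) (h : Lp.toTemperedDistribution (hF.toLp F) =
      Lp.toTemperedDistribution (hG.toLp G)) : F =ᵐ[volume] G :=
  (MemLp.toLp_eq_toLp_iff hF hG).1 (toTemperedDistribution_injective h)

/-- Square root of the frequency estimate: both rates are halved, C becomes √C, and k ≤ 16r/3
supplies the factor r. -/
theorem freq_bound_on_annulus {τ C c r k t z w W p a v N : ℝ} (hC : 0 < C) (hc : 0 < c)
    (hr : 0 < r) (ht : 0 ≤ t) (hk1 : 3 / 8 * r ≤ k) (hk2 : k ≤ 16 / 3 * r)
    (hw0 : 0 ≤ w) (hw : w ≤ W) (hp : 0 ≤ p) (ha : 0 ≤ a) (hv : 0 ≤ v)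
    (hN : p + (k * a + k * v) ≤ N)
    (hd : z ^ 2 ≤ Real.exp (-t / τ) * w ^ 2 + C * k ^ 2 *
      Real.exp (-(c * (k ^ 2 / (1 + k ^ 2))) * t) * (p ^ 2 + k ^ 2 * a ^ 2 + k ^ 2 * v ^ 2)) :
    z ≤ Real.exp (-t / (2 * τ)) * W +
      √C * (16 / 3) * r * Real.exp (-(c / 2 * (9 / 73) * min 1 (r ^ 2)) * t) * N := by
  have hk0 : 0 ≤ k := by nlinarith
  have n2 : 0 ≤ k * a := by positivity
  have n3 : 0 ≤ k * v := by positivity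
  have hN0 : 0 ≤ N := by linarith
  have hW0 : 0 ≤ W := hw0.trans hw
  have hrate := min_le_dissipation_rate hr hk1
  refine le_add_of_sq_le_sq_add_sq (by positivity) (by positivity) (hd.trans ?_)
  have hquad : p ^ 2 + k ^ 2 * a ^ 2 + k ^ 2 * v ^ 2 ≤ N ^ 2 := by
    rw [← mul_pow, ← mul_pow]
    calc _ ≤ (p + (k * a + k * v)) ^ 2 := by
          nlinarith [mul_nonneg hp n2, mul_nonneg hp n3, mul_nonneg n2 n3]
      _ ≤ _ := by gcongr
  have hexp1 : Real.exp (-t / τ) = Real.exp (-t / (2 * τ)) ^ 2 := by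
    rw [← Real.exp_nat_mul]; congr 1; push_cast; field_simp
  have hexp2 : Real.exp (-(c * (k ^ 2 / (1 + k ^ 2))) * t) ≤
      Real.exp (-(c / 2 * (9 / 73) * min 1 (r ^ 2)) * t) ^ 2 := by
    rw [← Real.exp_nat_mul]
    refine Real.exp_le_exp.2 ?_
    push_cast
    have : c * (9 / 73 * min 1 (r ^ 2)) * t ≤ c * (k ^ 2 / (1 + k ^ 2)) * t := by gcongr
    linarith
  refine add_le_add ?_ ?_
  · rw [hexp1, mul_pow]
    gcongr
  · calc C * k ^ 2 * Real.exp (-(c * (k ^ 2 / (1 + k ^ 2))) * t) *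
          (p ^ 2 + k ^ 2 * a ^ 2 + k ^ 2 * v ^ 2)
        ≤ C * (16 / 3 * r) ^ 2 * Real.exp (-(c / 2 * (9 / 73) * min 1 (r ^ 2)) * t) ^ 2 *
          N ^ 2 := by gcongr
      _ = √C ^ 2 * (16 / 3 * r) ^ 2 *
          Real.exp (-(c / 2 * (9 / 73) * min 1 (r ^ 2)) * t) ^ 2 * N ^ 2 := by
          rw [Real.sq_sqrt hC.le]
      _ = _ := by ring

theorem eLpNorm_two_le_of_ae_le {n : ℕ} {ι : Type*} [Fintype ι] {Z W : Rn n → ℂ}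
    {G : ι → Rn n → ℂ} {e₁ e₂ : ℝ} (he₁ : 0 ≤ e₁) (he₂ : 0 ≤ e₂) (hW : MemLp W 2)
    (hG : ∀ i, MemLp (G i) 2) (h : ∀ᵐ ξ, ‖Z ξ‖ ≤ e₁ * ‖W ξ‖ + e₂ * ∑ i, ‖G i ξ‖) :
    eLpNorm Z 2 volume ≤ ENNReal.ofReal e₁ * eLpNorm W 2 volume +
      ENNReal.ofReal e₂ * ∑ i, eLpNorm (G i) 2 volume := by
  have hNm : ∀ i, AEStronglyMeasurable (fun ξ => ‖G i ξ‖) volume := fun i => (hG i).1.norm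
  calc eLpNorm Z 2 volume
      ≤ eLpNorm (fun ξ => e₁ * ‖W ξ‖ + e₂ * ∑ i, ‖G i ξ‖) 2 volume := eLpNorm_mono_ae_real h
    _ ≤ eLpNorm (e₁ • fun ξ => ‖W ξ‖) 2 volume +
        eLpNorm (e₂ • ∑ i, fun ξ => ‖G i ξ‖) 2 volume := by
        refine le_trans (le_of_eq ?_) (eLpNorm_add_le (hW.1.norm.const_smul e₁)
          ((Finset.aestronglyMeasurable_sum _ fun i _ => hNm i).const_smul e₂) (by norm_num))
        congr 1
        ext ξ
        simp
    _ ≤ _ := by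
        rw [eLpNorm_const_smul, eLpNorm_const_smul, eLpNorm_norm,
          Real.enorm_of_nonneg he₁, Real.enorm_of_nonneg he₂]
        gcongr
        refine (eLpNorm_sum_le (fun i _ => hNm i) (by norm_num)).trans (le_of_eq ?_)
        simp only [eLpNorm_norm]

theorem exists_block_decay {τ β : ℝ} (hτ : 0 < τ) (hτβ : τ < β) :
    ∃ C c : ℝ, 0 < C ∧ 0 < c ∧ ∀ {n : ℕ} (P : LittlewoodPaley n) {u₀ u₁ u₂ : 𝓢'(Rn n, ℂ)}
      {u v w : ℝ → 𝓢'(Rn n, ℂ)}, IsMGTSolution τ β u₀ u₁ u₂ u v w → ∀ q : ℤ,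
      (∀ i, distLpNorm 2 (P.block q (vectorV τ u₀ u₁ u₂ i)) < ∞) →
      distLpNorm 2 (P.block q u₂) < ∞ → ∀ t, 0 ≤ t →
      distLpNorm 2 (P.block q (w t)) ≤
        ENNReal.ofReal (Real.exp (-t / (2 * τ))) * distLpNorm 2 (P.block q u₂) +
        ENNReal.ofReal (C * 2 ^ q * Real.exp (-(c * min 1 (((2 : ℝ) ^ q) ^ 2)) * t)) *
          ∑ i, distLpNorm 2 (P.block q (vectorV τ u₀ u₁ u₂ i)) := by
  obtain ⟨C, c, hC, hc, hdecay⟩ := exists_freq_decay hτ hτβ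
  refine ⟨√C * (16 / 3), c / 2 * (9 / 73), by positivity, by positivity, ?_⟩
  intro n P u₀ u₁ u₂ u v w hsol q hfin hfinw t ht
  have hπ := Real.pi_pos
  have hτC : (τ : ℂ) ≠ 0 := by exact_mod_cast hτ.ne'
  set r : ℝ := 2 ^ q with hrdef
  have hr : 0 < r := by positivity
  have hm := P.hasTemperateGrowth_symbol q
  obtain ⟨χ, hχs, hχ01, hχ1, hχ0⟩ := exists_annulus_cutoff n hr
  obtain ⟨K, hK⟩ := exists_laplacian_cutoff n hr
  have hχm : ∀ ξ, P.symbol q ξ ≠ 0 → χ ξ = 1 := fun ξ h =>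
    hχ1 ξ (P.symbol_support q ξ h).1 (P.symbol_support q ξ h).2
  have hKm : ∀ ξ, P.symbol q ξ ≠ 0 → K ξ = (((2 * Real.pi * ‖ξ‖) ^ 2 : ℝ) : ℂ) := fun ξ h =>
    hK ξ ((P.symbol_support q ξ h).2.trans (by gcongr; norm_num))
  have hχball : ∀ ξ, χ ξ ≠ 0 →
      3 / 8 * r / (2 * Real.pi) ≤ ‖ξ‖ ∧ ‖ξ‖ ≤ 16 / 3 * r / (2 * Real.pi) := by
    intro ξ h
    rw [div_le_iff₀ (by positivity), le_div_iff₀ (by positivity), mul_comm ‖ξ‖]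
    exact hχ0 ξ h
  have hχC : ContDiff ℝ (⊤ : ℕ∞) fun ξ => (χ ξ : ℂ) := Complex.ofRealCLM.contDiff.comp hχs
  have hχtg : (fun ξ => (χ ξ : ℂ)).HasTemperateGrowth :=
    HasCompactSupport.hasTemperateGrowth (hasCompactSupport_of_norm_le fun ξ hξ =>
      (hχball ξ fun h => hξ (by simp [h])).2) hχC
  choose G hG hVG hGn using fun i => exists_eq_toTemperedDistribution
    (T := P.freqBlock q (vectorV τ u₀ u₁ u₂ i)) (hfin i)
  obtain ⟨W₁, hW₁, hwW₁, hW₁n⟩ := exists_eq_toTemperedDistribution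
    (T := P.freqBlock q u₂) hfinw
  obtain ⟨A, hA, hfA, hA0, hAle⟩ := P.exists_freqBlock_of_gradient q hχs hχ01 hχm
    (by positivity) hχball (u₀ + (τ : ℂ) • u₁) (fun i => hG (.inr (.inl i)))
    (fun i => hVG (.inr (.inl i)))
  obtain ⟨V, hV, hfV, hV0, hVle⟩ := P.exists_freqBlock_of_gradient q hχs hχ01 hχm
    (by positivity) hχball u₁ (fun i => hG (.inr (.inr i))) (fun i => hVG (.inr (.inr i)))
  set W : Rn n → ℂ := fun ξ => χ ξ * W₁ ξ with hWdef
  have hW1 : ∀ ξ, ‖W ξ‖ ≤ ‖W₁ ξ‖ := fun ξ => by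
    rw [hWdef, norm_mul, Complex.norm_real, Real.norm_of_nonneg (hχ01 ξ).1]
    exact mul_le_of_le_one_left (norm_nonneg _) (hχ01 ξ).2
  have hW : MemLp W 2 := hW₁.of_le (hχC.continuous.aestronglyMeasurable.mul hW₁.1)
    (.of_forall hW1)
  have hfW : P.freqBlock q u₂ = Lp.toTemperedDistribution (hW.toLp W) := by
    rw [← smulLeftCLM_toTemperedDistribution hχtg hW₁ hW, ← hwW₁]
    ext g
    rw [TemperedDistribution.smulLeftCLM_apply_apply, P.freqBlock_apply, P.freqBlock_apply]
    congr 2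
    ext ξ
    simp only [SchwartzMap.smulLeftCLM_apply_apply hm, SchwartzMap.smulLeftCLM_apply_apply hχtg,
      smul_eq_mul]
    by_cases h : P.symbol q ξ = 0
    · simp [h]
    · simp [hχm ξ h]
  -- The hypotheses control only the gradients of u₀ + τu₁ and u₁; the block of u₀ is recovered from
  -- these two.
  set U : Rn n → ℂ := fun ξ => A ξ - τ * V ξ with hUdef
  have hU : MemLp U 2 := hA.sub (hV.const_mul (τ : ℂ))
  have hfU : P.freqBlock q u₀ = Lp.toTemperedDistribution (hU.toLp U) := by
    have h1 : P.freqBlock q u₀ = P.freqBlock q (u₀ + (τ : ℂ) • u₁) - (τ : ℂ) • P.freqBlock q u₁ := by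
      rw [P.freqBlock_add, P.freqBlock_smul]; abel
    rw [h1, hfA, hfV]
    ext g
    rw [sub_apply, smul_apply, toTemperedDistribution_toLp_apply,
      toTemperedDistribution_toLp_apply, toTemperedDistribution_toLp_apply, smul_eq_mul,
      ← integral_const_mul, ← integral_sub (integrable_schwartz_mul hA g)
        ((integrable_schwartz_mul hV g).const_mul _)]
    exact integral_congr_ae (.of_forall fun ξ => by simp only [hUdef]; ring)
  -- Both sides represent the block of u₁ + τu₂, but they agree only almost everywhere.
  have hPae : (fun ξ => V ξ + τ * W ξ) =ᵐ[volume] G (.inl ()) := by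
    have hVW : MemLp (fun ξ => V ξ + τ * W ξ) 2 := hV.add (hW.const_mul (τ : ℂ))
    refine toTemperedDistribution_toLp_congr hVW (hG _) ?_
    rw [← hVG]
    change _ = P.freqBlock q (u₁ + (τ : ℂ) • u₂)
    rw [P.freqBlock_add, P.freqBlock_smul, hfV, hfW]
    ext g
    rw [add_apply, smul_apply, toTemperedDistribution_toLp_apply,
      toTemperedDistribution_toLp_apply, toTemperedDistribution_toLp_apply, smul_eq_mul,
      ← integral_const_mul, ← integral_add (integrable_schwartz_mul hV g)
        ((integrable_schwartz_mul hW g).const_mul _)]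
    exact integral_congr_ae (.of_forall fun ξ => by ring)
  have hsupp : ∀ ξ, (U ξ, V ξ, W ξ) ≠ (0, 0, 0) → χ ξ ≠ 0 := by
    intro ξ h h0
    have hA' : A ξ = 0 := by by_contra hne; exact hA0 ξ hne h0
    have hV' : V ξ = 0 := by by_contra hne; exact hV0 ξ hne h0
    exact h (by simp [hUdef, hWdef, hA', hV', h0])
  obtain ⟨Z, hZ, hzZ, hZsol⟩ := exists_freq_solution (τ := τ) (β := β) K
    (κ := fun ξ => (2 * Real.pi * ‖ξ‖) ^ 2) (by fun_prop) (M := (16 / 3 * r) ^ 2)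
    (x := fun t => P.freqBlock q (u t)) (y := fun t => P.freqBlock q (v t))
    (z := fun t => P.freqBlock q (w t))
    (fun g t ht => by simpa only [P.freqBlock_apply] using hsol.deriv_u _ t ht)
    (fun g t ht => by simpa only [P.freqBlock_apply] using hsol.deriv_v _ t ht)
    (fun g t ht => by
      have h1 := (hsol.deriv_w (𝓕 (SchwartzMap.smulLeftCLM ℂ (P.symbol q) g)) t ht).const_mul
        ((τ : ℂ)⁻¹)
      simp only [inv_mul_cancel_left₀ hτC] at h1
      simp only [sub_apply, add_apply, smul_apply, smul_eq_mul] at h1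
      have h2 := P.freqBlock_laplacian q hKm (u t) g
      have h3 := P.freqBlock_laplacian q hKm (v t) g
      rw [P.freqBlock_apply] at h2 h3
      rw [h2, h3] at h1
      refine h1.congr_deriv ?_
      rw [P.freqBlock_apply q (w t)]
      ring)
    hU hV hW (fun ξ h => ⟨hK ξ (hχ0 ξ (hsupp ξ h)).2, by
      rw [abs_of_nonneg (by positivity)]
      have := (hχ0 ξ (hsupp ξ h)).2
      gcongr⟩)
    (by rw [hsol.init_u, hfU]) (by rw [hsol.init_v, hfV]) (by rw [hsol.init_w, hfW]) t ht
  set e₁ : ℝ := Real.exp (-t / (2 * τ)) with he₁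
  set e₂ : ℝ := √C * (16 / 3) * r * Real.exp (-(c / 2 * (9 / 73) * min 1 (r ^ 2)) * t) with he₂
  have hpt : ∀ᵐ ξ ∂volume, ‖Z ξ‖ ≤ e₁ * ‖W₁ ξ‖ + e₂ * ∑ i, ‖G i ξ‖ := by
    filter_upwards [hPae] with ξ hPξ
    obtain ⟨fu, fv, fw, fw', hfu, hfv, hfw, hfw', hu0, hv0, hw0, hwt⟩ := hZsol ξ
    set k : ℝ := 2 * Real.pi * ‖ξ‖ with hk
    have hk0 : 0 ≤ k := by positivity
    have hd := hdecay (k ^ 2) (by positivity) fu fv fw fw' hfu hfv hfw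
      (fun s => by rw [hfw' s]; field_simp; ring) t ht
    have hUA : U ξ + τ * V ξ = A ξ := by simp only [hUdef]; ring
    rw [hwt, hw0, hv0, hu0, hUA, hPξ] at hd
    have hS : 0 ≤ ∑ i, ‖G i ξ‖ := Finset.sum_nonneg fun i _ => norm_nonneg _
    have hsplit : ∑ i, ‖G i ξ‖ = ‖G (.inl ()) ξ‖ +
        (∑ i, ‖G (.inr (.inl i)) ξ‖ + ∑ i, ‖G (.inr (.inr i)) ξ‖) := by
      simp [Fintype.sum_sum_type]
    -- Off the support of `χ` all data vanish, and the decay estimate forces `Z ξ = 0`.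
    by_cases hχξ : χ ξ = 0
    · have hdata : (U ξ, V ξ, W ξ) = (0, 0, 0) := by
        by_contra h; exact hsupp ξ h hχξ
      simp only [Prod.mk.injEq] at hdata
      have hA' : A ξ = 0 := by by_contra hne; exact hA0 ξ hne hχξ
      rw [← hPξ, hA', hdata.2.1, hdata.2.2] at hd
      have hZ0 : ‖Z ξ‖ = 0 := by
        have : ‖Z ξ‖ ^ 2 ≤ 0 := by simpa using hd
        exact pow_eq_zero_iff two_ne_zero |>.1 (le_antisymm this (by positivity))
      rw [hZ0]
      positivity
    · refine freq_bound_on_annulus hC hc hr ht (hχ0 ξ hχξ).1 (hχ0 ξ hχξ).2 (norm_nonneg _)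
        (hW1 ξ) (norm_nonneg _) (norm_nonneg _) (norm_nonneg _) ?_ hd
      rw [hsplit]
      gcongr
      · exact hAle ξ
      · exact hVle ξ
  rw [P.block_eq q (w t)]
  refine (distLpNorm_fourierInv_le hZ hzZ).trans ((eLpNorm_two_le_of_ae_le
    (by positivity) (by positivity) hW₁ hG hpt).trans (le_of_eq ?_))
  simp only [hGn, hW₁n]
  rfl

end BlockDecay

/-! ### Dyadic sums of heat type -/

section DyadicSum

/-- Raise x ≤ exp x, at x = by/a, to the power a. -/
theorem rpow_mul_exp_neg_le {a b y : ℝ} (ha : 0 < a) (hb : 0 < b) (hy : 0 ≤ y) :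
    y ^ a * Real.exp (-b * y) ≤ (a / b) ^ a := by
  have h1 : b * y / a ≤ Real.exp (b * y / a) := by linarith [Real.add_one_le_exp (b * y / a)]
  have h2 : (b * y / a) ^ a ≤ Real.exp (b * y) := by
    calc (b * y / a) ^ a ≤ Real.exp (b * y / a) ^ a := by gcongr
      _ = Real.exp (b * y) := by rw [← Real.exp_mul]; congr 1; field_simp
  have h3 : y = (a / b) * (b * y / a) := by field_simp
  calc y ^ a * Real.exp (-b * y)
      = (a / b) ^ a * (b * y / a) ^ a * Real.exp (-b * y) := by
        rw [← Real.mul_rpow (by positivity) (by positivity), ← h3]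
    _ ≤ (a / b) ^ a * Real.exp (b * y) * Real.exp (-b * y) := by gcongr
    _ = (a / b) ^ a := by rw [mul_assoc, ← Real.exp_add]; simp

theorem exists_exp_neg_le_rpow {c α : ℝ} (hc : 0 < c) (hα : 0 < α) :
    ∃ C : ℝ≥0, ∀ t : ℝ, 0 ≤ t →
      ENNReal.ofReal (Real.exp (-c * t)) ≤ C * ENNReal.ofReal ((1 + t) ^ (-α / 2)) := by
  refine ⟨(Real.exp c * ((α / 2) / c) ^ (α / 2)).toNNReal, fun t ht => ?_⟩
  change _ ≤ ENNReal.ofReal _ * _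
  rw [← ENNReal.ofReal_mul (by positivity)]
  refine ENNReal.ofReal_le_ofReal ?_
  have h := rpow_mul_exp_neg_le (a := α / 2) (b := c) (y := 1 + t) (by positivity) hc (by positivity)
  have hp : (0 : ℝ) < (1 + t) ^ (α / 2) := by positivity
  have h2 : (1 + t) ^ (-α / 2) = ((1 + t) ^ (α / 2))⁻¹ := by
    rw [← Real.rpow_neg (by positivity)]; congr 1; ring
  rw [h2, ← div_eq_mul_inv, le_div_iff₀ hp]
  calc Real.exp (-c * t) * (1 + t) ^ (α / 2)
      = Real.exp c * ((1 + t) ^ (α / 2) * Real.exp (-c * (1 + t))) := by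
        rw [show -c * t = c + -c * (1 + t) by ring, Real.exp_add]; ring
    _ ≤ _ := by gcongr

/-- For j ≤ 0 the power is already geometric. For j ≥ 0, boundedness of y^α exp(-cy) at y = 4^j
bounds the term by a multiple of 2^(-jα). -/
theorem summable_dyadic_rpow_mul_exp {c α : ℝ} (hc : 0 < c) (hα : 0 < α) :
    Summable fun j : ℤ => ((2 : ℝ) ^ j) ^ α * Real.exp (-c * ((2 : ℝ) ^ j) ^ 2) := by
  have hρ : (2 : ℝ) ^ (-α) < 1 := Real.rpow_lt_one_of_one_lt_of_neg one_lt_two (by linarith)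
  have hgeo : Summable fun m : ℕ => ((2 : ℝ) ^ (-α)) ^ m :=
    summable_geometric_of_lt_one (by positivity) hρ
  have hpow : ∀ m : ℕ, ((2 : ℝ) ^ m) ^ (-α) = ((2 : ℝ) ^ (-α)) ^ m := fun m => by
    rw [← Real.rpow_natCast, ← Real.rpow_mul zero_le_two, ← Real.rpow_natCast,
      ← Real.rpow_mul zero_le_two, mul_comm]
  refine Summable.of_nat_of_neg ?_ ?_
  · refine Summable.of_nonneg_of_le (fun m => by positivity) (fun m => ?_)
      (hgeo.mul_left ((α / c) ^ α))
    rw [← hpow]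
    have hy : (0 : ℝ) < 2 ^ m := by positivity
    have h := rpow_mul_exp_neg_le (y := ((2 : ℝ) ^ m) ^ 2) hα hc (by positivity)
    have e : (((2 : ℝ) ^ m) ^ 2) ^ α = ((2 : ℝ) ^ m) ^ α * ((2 : ℝ) ^ m) ^ α := by
      rw [sq, Real.mul_rpow hy.le hy.le]
    rw [e] at h
    rw [zpow_natCast, Real.rpow_neg hy.le, ← div_eq_mul_inv, le_div_iff₀ (by positivity)]
    linarith
  · refine Summable.of_nonneg_of_le (fun m => by positivity) (fun m => ?_) hgeo
    rw [← hpow, zpow_neg, zpow_natCast, Real.inv_rpow (by positivity),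
      Real.rpow_neg (by positivity)]
    refine mul_le_of_le_one_right (by positivity) (Real.exp_le_one_iff.2 ?_)
    have : 0 ≤ c * (((2 : ℝ) ^ m)⁻¹) ^ 2 := by positivity
    linarith

/-- Parabolic scaling: with 2^m ≤ √(1+t) < 2^(m+1), the shift q ↦ q + m turns the sum into a fixed
convergent one times (1+t)^(-α/2). Replacing t by 1 + t costs exp c, as 4^q ≤ 1 for q < 0; rounding
√(1+t) to 2^m costs 2^α. -/
theorem exists_low_frequency_sum_le {c α : ℝ} (hc : 0 < c) (hα : 0 < α) :
    ∃ C : ℝ≥0, ∀ t : ℝ, 0 ≤ t →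
      ∑' q : ℤ, (if q < 0 then
        ENNReal.ofReal (((2 : ℝ) ^ q) ^ α * Real.exp (-(c * ((2 : ℝ) ^ q) ^ 2) * t)) else 0) ≤
      C * ENNReal.ofReal ((1 + t) ^ (-α / 2)) := by
  set H : ℤ → ℝ := fun j => ((2 : ℝ) ^ j) ^ α * Real.exp (-c * ((2 : ℝ) ^ j) ^ 2) with hH
  have hHs := summable_dyadic_rpow_mul_exp hc hα
  have hH0 : ∀ j, 0 ≤ H j := fun j => by positivity
  refine ⟨(Real.exp c * 2 ^ α * ∑' j, H j).toNNReal, fun t ht => ?_⟩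
  have hsum0 : 0 ≤ ∑' j, H j := tsum_nonneg hH0
  set x : ℝ := (1 + t) ^ (1 / 2 : ℝ) with hx
  have hx0 : 0 < x := by positivity
  have hx2 : x ^ 2 = 1 + t := by
    rw [hx, ← Real.rpow_natCast, ← Real.rpow_mul (by positivity)]; norm_num
  have hxα : (1 + t) ^ (-α / 2) = x ^ (-α) := by
    rw [hx, ← Real.rpow_mul (by positivity)]; congr 1; ring
  obtain ⟨m, hm1, hm2⟩ := exists_mem_Ico_zpow hx0 one_lt_two
  have hterm : ∀ q : ℤ, q < 0 →
      ((2 : ℝ) ^ q) ^ α * Real.exp (-(c * ((2 : ℝ) ^ q) ^ 2) * t) ≤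
        Real.exp c * 2 ^ α * x ^ (-α) * H (q + m) := by
    intro q hq
    have hy : (0 : ℝ) < 2 ^ q := by positivity
    have hy1 : (2 : ℝ) ^ q ≤ 1 := zpow_le_one_of_nonpos₀ one_le_two hq.le
    have e1 : Real.exp (-(c * ((2 : ℝ) ^ q) ^ 2) * t) ≤
        Real.exp c * Real.exp (-c * ((2 : ℝ) ^ (q + m)) ^ 2) := by
      rw [← Real.exp_add]
      refine Real.exp_le_exp.2 ?_
      have h1 : ((2 : ℝ) ^ (q + m)) ^ 2 ≤ ((2 : ℝ) ^ q) ^ 2 * (1 + t) := by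
        rw [zpow_add₀ two_ne_zero, mul_pow, ← hx2]
        gcongr
      have h2 : ((2 : ℝ) ^ q) ^ 2 ≤ 1 := pow_le_one₀ hy.le hy1
      nlinarith
    have e2 : ((2 : ℝ) ^ q) ^ α ≤ 2 ^ α * x ^ (-α) * ((2 : ℝ) ^ (q + m)) ^ α := by
      rw [Real.rpow_neg hx0.le, zpow_add₀ two_ne_zero, Real.mul_rpow (by positivity) (by positivity)]
      have h1 : x ^ α ≤ 2 ^ α * ((2 : ℝ) ^ m) ^ α := by
        rw [← Real.mul_rpow (by positivity) (by positivity)]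
        refine Real.rpow_le_rpow hx0.le ?_ hα.le
        rw [mul_comm, ← zpow_add_one₀ two_ne_zero]
        exact hm2.le
      have h2 : 0 < x ^ α := by positivity
      have e : 2 ^ α * (x ^ α)⁻¹ * (((2 : ℝ) ^ q) ^ α * ((2 : ℝ) ^ m) ^ α) =
          ((2 : ℝ) ^ q) ^ α * ((2 ^ α * ((2 : ℝ) ^ m) ^ α) / x ^ α) := by
        field_simp
      rw [e]
      exact le_mul_of_one_le_right (by positivity) ((one_le_div h2).2 h1)
    calc _ ≤ (2 ^ α * x ^ (-α) * ((2 : ℝ) ^ (q + m)) ^ α) *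
          (Real.exp c * Real.exp (-c * ((2 : ℝ) ^ (q + m)) ^ 2)) := by gcongr
      _ = _ := by simp only [hH]; ring
  have hconst : 0 ≤ Real.exp c * 2 ^ α * x ^ (-α) := by positivity
  calc ∑' q : ℤ, (if q < 0 then
        ENNReal.ofReal (((2 : ℝ) ^ q) ^ α * Real.exp (-(c * ((2 : ℝ) ^ q) ^ 2) * t)) else 0)
      ≤ ∑' q : ℤ, ENNReal.ofReal (Real.exp c * 2 ^ α * x ^ (-α)) * ENNReal.ofReal (H (q + m)) := by
        refine ENNReal.tsum_le_tsum fun q => ?_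
        split_ifs with hq
        · rw [← ENNReal.ofReal_mul hconst]
          exact ENNReal.ofReal_le_ofReal (hterm q hq)
        · exact zero_le
    _ = ENNReal.ofReal (Real.exp c * 2 ^ α * x ^ (-α)) * ENNReal.ofReal (∑' j, H j) := by
        rw [ENNReal.tsum_mul_left, ENNReal.ofReal_tsum_of_nonneg hH0 hHs]
        congr 1
        exact (Equiv.addRight m).tsum_eq fun j => ENNReal.ofReal (H j)
    _ = _ := by
        rw [← ENNReal.ofReal_mul hconst, hxα]
        change _ = ENNReal.ofReal _ * _
        rw [← ENNReal.ofReal_mul (by positivity)]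
        congr 1
        ring

end DyadicSum

/-! ### Besov norms and the high–low splitting -/

section Besov

variable {n : ℕ} (P : LittlewoodPaley n)

theorem LittlewoodPaley.besovNorm_one (s : ℝ) (f : 𝓢'(Rn n, ℂ)) :
    P.besovNorm s 2 1 f =
      ∑' q : ℤ, (2 : ℝ≥0∞) ^ ((q : ℝ) * s) * distLpNorm 2 (P.block q f) := by
  simp [besovNorm]

theorem LittlewoodPaley.le_besovNorm_top (s : ℝ) (f : 𝓢'(Rn n, ℂ)) (q : ℤ) :
    (2 : ℝ≥0∞) ^ ((q : ℝ) * s) * distLpNorm 2 (P.block q f) ≤ P.besovNorm s 2 ∞ f := by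
  rw [besovNorm, if_pos rfl]
  exact le_iSup (fun q : ℤ => (2 : ℝ≥0∞) ^ ((q : ℝ) * s) * distLpNorm 2 (P.block q f)) q

theorem LittlewoodPaley.distLpNorm_block_lt_top {s : ℝ} {f : 𝓢'(Rn n, ℂ)}
    (h : P.MemBesov s 2 1 f) (q : ℤ) : distLpNorm 2 (P.block q f) < ∞ := by
  rw [MemBesov, besovNorm_one] at h
  have h1 := (ENNReal.le_tsum q).trans_lt h
  by_contra hne
  rw [not_lt, top_le_iff] at hne
  rw [hne, ENNReal.mul_top (ENNReal.rpow_pos (by norm_num) (by norm_num)).ne'] at h1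
  exact lt_irrefl _ h1

theorem LittlewoodPaley.vecBesovNorm_one {ι : Type*} [Fintype ι] (s : ℝ) (f : ι → 𝓢'(Rn n, ℂ)) :
    P.vecBesovNorm s 2 1 f =
      ∑' q : ℤ, (2 : ℝ≥0∞) ^ ((q : ℝ) * s) * ∑ i, distLpNorm 2 (P.block q (f i)) := by
  simp only [vecBesovNorm, besovNorm_one, Finset.mul_sum]
  exact (Summable.tsum_finsetSum fun i _ => ENNReal.summable).symm

theorem LittlewoodPaley.le_vecBesovNorm_top {ι : Type*} [Fintype ι] (s : ℝ)
    (f : ι → 𝓢'(Rn n, ℂ)) (q : ℤ) :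
    (2 : ℝ≥0∞) ^ ((q : ℝ) * s) * ∑ i, distLpNorm 2 (P.block q (f i)) ≤
      P.vecBesovNorm s 2 ∞ f := by
  rw [vecBesovNorm, Finset.mul_sum]
  exact Finset.sum_le_sum fun i _ => P.le_besovNorm_top s (f i) q

theorem ofReal_zpow_rpow (q : ℤ) (a : ℝ) :
    ENNReal.ofReal (((2 : ℝ) ^ q) ^ a) = (2 : ℝ≥0∞) ^ ((q : ℝ) * a) := by
  rw [← Real.rpow_intCast, ← Real.rpow_mul zero_le_two,
    ← ENNReal.ofReal_rpow_of_pos zero_lt_two]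
  simp

/-- Splitting of a dyadic term into high and low frequencies. -/
theorem dyadic_term_le {σ s C c t : ℝ} (hC : 0 ≤ C) (q : ℤ) {N S : ℝ≥0∞}
    (hS : (2 : ℝ≥0∞) ^ ((q : ℝ) * (-s)) * N ≤ S) :
    (2 : ℝ≥0∞) ^ ((q : ℝ) * σ) *
      (ENNReal.ofReal (C * 2 ^ q * Real.exp (-(c * min 1 (((2 : ℝ) ^ q) ^ 2)) * t)) * N) ≤
    ENNReal.ofReal C * ENNReal.ofReal (Real.exp (-c * t)) *
        ((2 : ℝ≥0∞) ^ ((q : ℝ) * (σ + 1)) * N) +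
      ENNReal.ofReal C * (if q < 0 then ENNReal.ofReal
        (((2 : ℝ) ^ q) ^ (σ + s + 1) * Real.exp (-(c * ((2 : ℝ) ^ q) ^ 2) * t)) else 0) * S := by
  have h2 : ENNReal.ofReal ((2 : ℝ) ^ q) = (2 : ℝ≥0∞) ^ ((q : ℝ) * 1) := by
    rw [← ofReal_zpow_rpow, Real.rpow_one]
  have hmul : (2 : ℝ≥0∞) ^ ((q : ℝ) * σ) * (2 : ℝ≥0∞) ^ ((q : ℝ) * 1) =
      (2 : ℝ≥0∞) ^ ((q : ℝ) * (σ + 1)) := by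
    rw [← ENNReal.rpow_add _ _ two_ne_zero ENNReal.ofNat_ne_top, mul_add]
  rw [ENNReal.ofReal_mul (by positivity), ENNReal.ofReal_mul hC, h2]
  -- For q < 0, writing 2^(q(σ+1)) = 2^(q(σ+s+1)) 2^(-qs) lets `S` bound the block. For q ≥ 0 the
  -- rate is the constant c, and 2^q shifts σ to σ + 1.
  by_cases hq : q < 0
  · have hle : ((2 : ℝ) ^ q) ^ 2 ≤ 1 :=
      pow_le_one₀ (by positivity) (zpow_le_one_of_nonpos₀ one_le_two hq.le)
    rw [min_eq_right hle, if_pos hq, ENNReal.ofReal_mul (by positivity), ofReal_zpow_rpow]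
    refine le_add_of_nonneg_of_le zero_le ?_
    have hsplit : (2 : ℝ≥0∞) ^ ((q : ℝ) * (σ + 1)) =
        (2 : ℝ≥0∞) ^ ((q : ℝ) * (σ + s + 1)) * (2 : ℝ≥0∞) ^ ((q : ℝ) * (-s)) := by
      rw [← ENNReal.rpow_add _ _ two_ne_zero ENNReal.ofNat_ne_top]; congr 1; ring
    set E := ENNReal.ofReal (Real.exp (-(c * ((2 : ℝ) ^ q) ^ 2) * t))
    calc _ = ENNReal.ofReal C * ((2 : ℝ≥0∞) ^ ((q : ℝ) * σ) * (2 : ℝ≥0∞) ^ ((q : ℝ) * 1)) *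
          E * N := by ring
      _ = ENNReal.ofReal C * ((2 : ℝ≥0∞) ^ ((q : ℝ) * (σ + s + 1)) * E) *
          ((2 : ℝ≥0∞) ^ ((q : ℝ) * (-s)) * N) := by rw [hmul, hsplit]; ring
      _ ≤ _ := by gcongr
  · have hle : 1 ≤ ((2 : ℝ) ^ q) ^ 2 := one_le_pow₀ (one_le_zpow₀ one_le_two (not_lt.1 hq))
    rw [min_eq_left hle, mul_one c, if_neg hq, mul_zero, zero_mul, add_zero, ← hmul]
    refine le_of_eq ?_
    ring

end Besov

/-! ### Summation over the blocks -/

theorem proposition5p6 (β : ℝ) (hβ : 0 < β) :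
    ∃ τ₀ : ℝ, 0 < τ₀ ∧ ∀ τ : ℝ, 0 < τ → τ < β → τ < τ₀ →
      ∀ (n : ℕ) (_ : 1 ≤ n) (P : LittlewoodPaley n) (σ s : ℝ), 0 < σ + s + 1 →
        ∃ C : ℝ≥0, ∀ (u₀ u₁ u₂ : 𝓢'(Rn n, ℂ)) (u v w : ℝ → 𝓢'(Rn n, ℂ)),
          IsMGTSolution τ β u₀ u₁ u₂ u v w →
          P.VecMemBesov (σ + 1) 2 1 (vectorV τ u₀ u₁ u₂) →
          P.VecMemBesov (-s) 2 ∞ (vectorV τ u₀ u₁ u₂) →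
          P.MemBesov σ 2 1 u₂ →
          ∀ t : ℝ, 0 ≤ t →
            P.MemBesov σ 2 1 (w t) ∧
            P.besovNorm σ 2 1 (w t) ≤
              (C : ℝ≥0∞) *
                (P.vecBesovNorm (σ + 1) 2 1 (vectorV τ u₀ u₁ u₂) +
                  P.vecBesovNorm (-s) 2 ∞ (vectorV τ u₀ u₁ u₂) +
                  P.besovNorm σ 2 1 u₂) *
                ENNReal.ofReal ((1 + t) ^ (-(σ + s + 1) / 2)) := by
  -- The energy estimate only asks for β - τ > 0, so τ₀ = β serves.
  refine ⟨β, hβ, fun τ hτ hτβ _ n _ P σ s hα => ?_⟩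
  obtain ⟨C, c, hC, hc, hblock⟩ := exists_block_decay hτ hτβ
  obtain ⟨C₁, hC₁⟩ := exists_exp_neg_le_rpow (c := 1 / (2 * τ)) (by positivity) hα
  obtain ⟨C₂, hC₂⟩ := exists_exp_neg_le_rpow hc hα
  obtain ⟨C₃, hC₃⟩ := exists_low_frequency_sum_le hc hα
  -- In order: relaxation of the datum w₀, high frequencies, low frequencies.
  refine ⟨C₁ + C.toNNReal * C₂ + C.toNNReal * C₃, ?_⟩
  intro u₀ u₁ u₂ u v w hsol hV1 hV2 hw t ht
  set B₁ := P.vecBesovNorm (σ + 1) 2 1 (vectorV τ u₀ u₁ u₂) with hB₁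
  set B₂ := P.vecBesovNorm (-s) 2 ∞ (vectorV τ u₀ u₁ u₂) with hB₂
  set B₀ := P.besovNorm σ 2 1 u₂ with hB₀
  set D := ENNReal.ofReal ((1 + t) ^ (-(σ + s + 1) / 2)) with hD
  have hB₁t : B₁ < ∞ := ENNReal.sum_lt_top.2 fun i _ => hV1 i
  have hB₂t : B₂ < ∞ := ENNReal.sum_lt_top.2 fun i _ => hV2 i
  have hmain : P.besovNorm σ 2 1 (w t) ≤
      ((C₁ + C.toNNReal * C₂ + C.toNNReal * C₃ : ℝ≥0) : ℝ≥0∞) * (B₁ + B₂ + B₀) * D := by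
    rw [P.besovNorm_one]
    calc ∑' q : ℤ, (2 : ℝ≥0∞) ^ ((q : ℝ) * σ) * distLpNorm 2 (P.block q (w t))
        ≤ ∑' q : ℤ, (ENNReal.ofReal (Real.exp (-(1 / (2 * τ)) * t)) *
              ((2 : ℝ≥0∞) ^ ((q : ℝ) * σ) * distLpNorm 2 (P.block q u₂)) +
            (ENNReal.ofReal C * ENNReal.ofReal (Real.exp (-c * t)) *
              ((2 : ℝ≥0∞) ^ ((q : ℝ) * (σ + 1)) *
                ∑ i, distLpNorm 2 (P.block q (vectorV τ u₀ u₁ u₂ i))) +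
            ENNReal.ofReal C * (if q < 0 then ENNReal.ofReal (((2 : ℝ) ^ q) ^ (σ + s + 1) *
              Real.exp (-(c * ((2 : ℝ) ^ q) ^ 2) * t)) else 0) * B₂)) := by
          refine ENNReal.tsum_le_tsum fun q => ?_
          have h := hblock P hsol q (fun i => P.distLpNorm_block_lt_top (hV1 i) q)
            (P.distLpNorm_block_lt_top hw q) t ht
          refine (mul_le_mul_right h _).trans ?_
          rw [mul_add]
          refine add_le_add (le_of_eq ?_) (dyadic_term_le hC.le q
            (P.le_vecBesovNorm_top (-s) (vectorV τ u₀ u₁ u₂) q))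
          rw [show -(1 / (2 * τ)) * t = -t / (2 * τ) by ring]
          ring
      _ = ENNReal.ofReal (Real.exp (-(1 / (2 * τ)) * t)) * B₀ +
          (ENNReal.ofReal C * ENNReal.ofReal (Real.exp (-c * t)) * B₁ +
            ENNReal.ofReal C * (∑' q : ℤ, (if q < 0 then ENNReal.ofReal
              (((2 : ℝ) ^ q) ^ (σ + s + 1) * Real.exp (-(c * ((2 : ℝ) ^ q) ^ 2) * t)) else 0)) *
                B₂) := by
          rw [ENNReal.tsum_add, ENNReal.tsum_add, ENNReal.tsum_mul_left, ENNReal.tsum_mul_left,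
            ENNReal.tsum_mul_right, ENNReal.tsum_mul_left, hB₀, hB₁, P.besovNorm_one,
            P.vecBesovNorm_one]
      _ ≤ C₁ * D * B₀ + (ENNReal.ofReal C * (C₂ * D) * B₁ +
            ENNReal.ofReal C * (C₃ * D) * B₂) := by
          gcongr
          · exact hC₁ t ht
          · exact hC₂ t ht
          · exact hC₃ t ht
      _ ≤ C₁ * D * (B₁ + B₂ + B₀) + (ENNReal.ofReal C * (C₂ * D) * (B₁ + B₂ + B₀) +
            ENNReal.ofReal C * (C₃ * D) * (B₁ + B₂ + B₀)) := by
          gcongr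
          · exact le_add_self
          · rw [add_assoc]; exact le_self_add
          · rw [add_right_comm]; exact le_add_self
      _ = _ := by
          rw [ENNReal.ofReal]
          push_cast
          ring
  refine ⟨hmain.trans_lt ?_, hmain⟩
  exact ENNReal.mul_lt_top (ENNReal.mul_lt_top ENNReal.coe_lt_top
    (ENNReal.add_lt_top.2 ⟨ENNReal.add_lt_top.2 ⟨hB₁t, hB₂t⟩, hw⟩)) ENNReal.ofReal_lt_top
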